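/- Let $\Delta^{*n}$ be the punctured polydisk $\{0<|s_j|<1\}$, covered by the product $U^n$ of upper half planes via $s_j=e^{2\pi i z_j}$, and let $\mathcal V\to\Delta^{*n}$ be a variation of graded-polarized mixed Hodge structure with unipotent monodromy $T_1,\dots,T_n$ ($T_j$ being parallel translation along the counterclockwise loop in the variable $s_j$). Put $N_j=-\log T_j$. Let $V=V_{\mathbb Q}\otimes\mathbb C$ be the space of flat multivalued sections of $\mathcal V$ (identified with the central fibre of the canonical extension by $\sigma\mapsto e^{\sum_j z_jN_j}\sigma$), with its weight filtration $W$ and its forms $\mathcal S_k$ on $Gr^W_k$. Let $F(z)$, $z\in U^n$, be the period map of $\mathcal V$, and let $\psi$ be the untwisted period map, defined on $\Delta^{*n}$ by $F(z)=e^{\sum_j z_jN_j}.\psi(s)$. Assume that $\mathcal V$ is admissible: $\psi$ extends to a holomorphic map on $\Delta^n$ with values in the compact dual $\check{\mathcal M}$ of the classifying space, and, with $F_\infty=\psi(0)$, the data $(W,\mathcal S,F_\infty,N_1,\dots,N_n)$ are an infinitesimal mixed Hodge module, i.e. the $N_j$ are commuting nilpotent infinitesimal isometries with $N_jF^p_\infty\subseteq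 F^{p-1}_\infty$ and $N_jW_k\subseteq W_k$; on each $Gr^W_k$ the filtration induced by $e^{\sum_j z_jN_j}.F_\infty$ is a pure Hodge structure of weight $k$ polarized by $\mathcal S_k$ whenever all $\operatorname{Im}z_j$ are large enough; and for every $J\subseteq\{1,\dots,n\}$ the relative weight filtration ${}^rW(\sum_{j\in J}N_j,W)$ exists and is shifted by $-2$ by each $N_j$, $j\in J$. Let ${}^rW={}^rW(N_1+\dots+N_n,W)$, let $I^{p,q}$ be the Deligne bigrading of the limiting mixed Hodge structure $(F_\infty,{}^rW)$, and let $U^p_\infty=\bigoplus_q I^{p,q}$. Let $G_{\mathbb C}$ be the group of those $g\in GL(V)$ which preserve $W$ and induce isometries of the forms $\mathcal S_k$. Let $\wp_a$ be the space of those $\alpha\in Lie(G_{\mathbb C})$ with $\alpha(U^p_\infty)\subseteq U^{p+a}_\infty$ for all $p$, and let $q_\infty=\bigoplus_{a<0}\wp_a$. Let $0<r\le 1$ and let $\Gamma:\Delta^n_r\to q_\infty$ be holomorphic with $\Gamma(0)=0$ and $\psi(s)=e^{\Gamma(s)}.F_\infty$ on the polydisk $\Delta^n_r$ of radius $r$.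 Put $$\Omega=\frac1{2\pi i}\sum_{j=1}^n\frac{ds_j}{s_j}\otimes N_j,\qquad X(z)=\log\bigl(e^{\sum_j z_jN_j}e^{\Gamma(s)}\bigr),\quad s_j=e^{2\pi i z_j}.$$ Then on $\Delta^{*n}_r$ the 1-form $$e^{-\operatorname{ad}\Gamma}\,\Omega+e^{-\Gamma}\,\partial e^{\Gamma}$$ takes its values in $\wp_{-1}$. Moreover, let $\Gamma_{-1}$ and $X_{-1}$ be the components of $\Gamma$ and $X$ of degree $-1$ relative to the grading of $\mathfrak{gl}(V)$ by its subspaces of endomorphisms mapping $U^p_\infty$ into $U^{p+a}_\infty$ for all $p$ ($a\in\mathbb Z$). They take their values in $\wp_{-1}$, $\Gamma_{-1}$ is holomorphic on $\Delta^n_r$, and $$\partial X_{-1}=\Omega+\partial\Gamma_{-1}$$ (the right hand side being pulled back by $s_j=e^{2\pi iz_j}$). This 1-form is a Higgs field on the product bundle $V\times\Delta^{*n}_r\to\Delta^{*n}_r$: it is holomorphic and $$(\Omega+\partial\Gamma_{-1})\wedge(\Omega+\partial\Gamma_{-1})=0.$$ -/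

import Mathlib

open scoped TensorProduct

universe u

noncomputable section

/-! ### Rational vector spaces, complexification and filtrations -/

section LinearAlgebra

variable {H : Type u} [AddCommGroup H] [Module ℚ H]

/-- Complex conjugation `c ⊗ h ↦ c̄ ⊗ h` on `H_ℂ = ℂ ⊗ H`. -/
def conjC : (ℂ ⊗[ℚ] H) →ₛₗ[starRingEnd ℂ] (ℂ ⊗[ℚ] H) where
  toFun := LinearMap.rTensor H ((Complex.conjAe.toLinearMap).restrictScalars ℚ)
  map_add' := fun x y => map_add _ x y
  map_smul' := fun c x => by
    induction x using TensorProduct.induction_on with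
    | zero => simp
    | tmul a h => simp [TensorProduct.smul_tmul']
    | add x y hx hy => rw [smul_add, map_add, hx, hy, map_add, smul_add]

/-- The complex conjugate of a complex subspace of `H_ℂ`. -/
def conjSub (U : Submodule ℂ (ℂ ⊗[ℚ] H)) : Submodule ℂ (ℂ ⊗[ℚ] H) := U.comap conjC

/-- A finite increasing (weight) filtration, defined over `ℚ`. -/
structure IsWeightFiltration (W : ℤ → Submodule ℚ H) : Prop where
  mono : Monotone W
  eq_bot : ∃ k, W k = ⊥
  eq_top : ∃ k, W k = ⊤

/-- A finite decreasing (Hodge) filtration of `H_ℂ`. -/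
structure IsHodgeFiltration (F : ℤ → Submodule ℂ (ℂ ⊗[ℚ] H)) : Prop where
  anti : Antitone F
  eq_bot : ∃ p, F p = ⊥
  eq_top : ∃ p, F p = ⊤

/-- `Gr^W_k = W_k / W_{k-1}`. -/
abbrev Gr (W : ℤ → Submodule ℚ H) (k : ℤ) : Type u :=
  ↥(W k) ⧸ (W (k - 1)).submoduleOf (W k)

/-- The projection `W_k → Gr^W_k`. -/
abbrev toGr (W : ℤ → Submodule ℚ H) (k : ℤ) : ↥(W k) →ₗ[ℚ] Gr W k :=
  ((W (k - 1)).submoduleOf (W k)).mkQ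

/-- The inclusion `W_k ⊗ ℂ → H_ℂ`. -/
abbrev inclC (W : ℤ → Submodule ℚ H) (k : ℤ) : (ℂ ⊗[ℚ] ↥(W k)) →ₗ[ℂ] (ℂ ⊗[ℚ] H) :=
  (W k).subtype.baseChange ℂ

/-- The projection `W_k ⊗ ℂ → Gr^W_k ⊗ ℂ`. -/
abbrev toGrC (W : ℤ → Submodule ℚ H) (k : ℤ) : (ℂ ⊗[ℚ] ↥(W k)) →ₗ[ℂ] (ℂ ⊗[ℚ] Gr W k) :=
  (toGr W k).baseChange ℂ

/-- The filtration `F^p Gr^W_k = (F^p ∩ W_k + W_{k-1}) / W_{k-1}` of `Gr^W_k ⊗ ℂ`. -/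
def grF (W : ℤ → Submodule ℚ H) (F : ℤ → Submodule ℂ (ℂ ⊗[ℚ] H)) (k p : ℤ) :
    Submodule ℂ (ℂ ⊗[ℚ] Gr W k) :=
  ((F p).comap (inclC W k)).map (toGrC W k)

/-- The filtration `F` of `H_ℂ` is a pure Hodge structure of weight `k` polarized by `Q`. -/
structure IsPolarizedHodge (k : ℤ) (F : ℤ → Submodule ℂ (ℂ ⊗[ℚ] H))
    (Q : LinearMap.BilinForm ℚ H) : Prop where
  filtration : IsHodgeFiltration F
  opposed : ∀ p, IsCompl (F p) (conjSub (F (k + 1 - p)))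
  parity : ∀ u v, Q u v = (-1 : ℚ) ^ k * Q v u
  nondegenerate : Q.Nondegenerate
  /-- first Riemann bilinear relation -/
  orthogonal : ∀ p, ∀ u ∈ F p, ∀ v ∈ F (k + 1 - p), (Q.baseChange ℂ) u v = 0
  /-- second Riemann bilinear relation, on `H^{p,q} = F^p ∩ conj F^q`, `p + q = k` -/
  positive : ∀ p q, p + q = k → ∀ v ∈ F p ⊓ conjSub (F q), v ≠ 0 →
    0 < (Complex.I ^ (p - q) * (Q.baseChange ℂ) v (conjC v)).re

/-- `Lie(G_ℂ)`, where `G_ℂ` is the group of the `g ∈ GL(H_ℂ)` which preserve `W` and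
induce isometries of the forms `S_k` on `Gr^W_k`: the endomorphisms `α` preserving `W` (with
restriction `αk` to `W_k`) whose induced maps `Gr_k(α) = βk` are infinitesimal isometries. -/
def lieG (W : ℤ → Submodule ℚ H) (S : ∀ k, LinearMap.BilinForm ℚ (Gr W k)) :
    Submodule ℂ (Module.End ℂ (ℂ ⊗[ℚ] H)) where
  carrier := {α | ∀ k, ∃ (αk : Module.End ℂ (ℂ ⊗[ℚ] ↥(W k)))
      (βk : Module.End ℂ (ℂ ⊗[ℚ] Gr W k)),
      (∀ x, α (inclC W k x) = inclC W k (αk x)) ∧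
      (∀ x, toGrC W k (αk x) = βk (toGrC W k x)) ∧
      ∀ u v, ((S k).baseChange ℂ) (βk u) v + ((S k).baseChange ℂ) u (βk v) = 0}
  zero_mem' := fun k => ⟨0, 0, by simp, by simp, by simp⟩
  add_mem' := by
    intro α α' h h' k
    obtain ⟨a, b, h1, h2, h3⟩ := h k
    obtain ⟨a', b', h1', h2', h3'⟩ := h' k
    refine ⟨a + a', b + b', fun x => by simp only [LinearMap.add_apply, map_add, h1, h1'],
      fun x => by simp only [LinearMap.add_apply, map_add, h2, h2'], fun u v => ?_⟩
    have e := h3 u v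
    have e' := h3' u v
    simp only [LinearMap.add_apply, map_add]
    linear_combination e + e'
  smul_mem' := by
    intro c α h k
    obtain ⟨a, b, h1, h2, h3⟩ := h k
    refine ⟨c • a, c • b, fun x => by simp only [LinearMap.smul_apply, map_smul, h1],
      fun x => by simp only [LinearMap.smul_apply, map_smul, h2], fun u v => ?_⟩
    have e := h3 u v
    simp only [LinearMap.smul_apply, map_smul, smul_eq_mul]
    linear_combination c * e

/-! ### Monodromy weight filtrations -/

/-- `M` is the monodromy weight filtration `W(N)` of the nilpotent endomorphism `N`:
`N M_j ⊆ M_{j-2}` and `N^l : Gr^M_l → Gr^M_{-l}` is an isomorphism for all `l ≥ 0`. -/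
structure IsMonodromyWeight (N : Module.End ℚ H) (M : ℤ → Submodule ℚ H) : Prop where
  filtration : IsWeightFiltration M
  shift : ∀ j, (M j).map N ≤ M (j - 2)
  injective : ∀ l : ℕ, ∀ x ∈ M l, (N ^ l) x ∈ M (-(l : ℤ) - 1) → x ∈ M ((l : ℤ) - 1)
  surjective : ∀ l : ℕ, ∀ y ∈ M (-(l : ℤ)), ∃ x ∈ M l, (N ^ l) x - y ∈ M (-(l : ℤ) - 1)

/-- `M` is the relative weight filtration `ʳW(N, W)`: `N M_j ⊆ M_{j-2}`, and on each `Gr^W_k`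
the filtration `M` induces the shifted filtration `W(N : Gr^W_k → Gr^W_k)[-k]`, whose
`j`-th term is `W(N : Gr^W_k → Gr^W_k)_{j-k}`. -/
structure IsRelativeWeight (N : Module.End ℚ H) (W M : ℤ → Submodule ℚ H) : Prop where
  filtration : IsWeightFiltration M
  shift : ∀ j, (M j).map N ≤ M (j - 2)
  graded : ∀ k, ∃ Nk : Module.End ℚ (Gr W k),
    (∀ x x' : ↥(W k), N x = x' → Nk (toGr W k x) = toGr W k x') ∧
    IsMonodromyWeight Nk (fun j => ((M (j + k)).submoduleOf (W k)).map (toGr W k))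

open Classical in
/-- The relative weight filtration `ʳW(N, W)` (it is unique when it exists). -/
def relativeWeight (N : Module.End ℚ H) (W : ℤ → Submodule ℚ H) : ℤ → Submodule ℚ H :=
  if h : ∃ M, IsRelativeWeight N W M then h.choose else fun _ => ⊥

/-! ### The Deligne bigrading and the induced grading of `Lie(G_ℂ)` -/

/-- `I` is the Deligne bigrading of `(F, W)`: `H_ℂ = ⨁ I^{p,q}`, `F^p = ⨁_{r ≥ p} I^{r,s}`,
`W_k = ⨁_{r + s ≤ k} I^{r,s}` and `I^{p,q} = conj I^{q,p}` modulo `⨁_{r < p, s < q} I^{r,s}`. -/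
structure IsDeligneBigrading (F : ℤ → Submodule ℂ (ℂ ⊗[ℚ] H)) (W : ℤ → Submodule ℚ H)
    (I : ℤ → ℤ → Submodule ℂ (ℂ ⊗[ℚ] H)) : Prop where
  internal : DirectSum.IsInternal (fun pq : ℤ × ℤ => I pq.1 pq.2)
  hodge : ∀ p, F p = ⨆ (r : ℤ) (_ : p ≤ r) (s : ℤ), I r s
  weight : ∀ k, (W k).baseChange ℂ = ⨆ (r : ℤ) (s : ℤ) (_ : r + s ≤ k), I r s
  conj : ∀ p q, I p q ⊔ (⨆ (r : ℤ) (_ : r < p) (s : ℤ) (_ : s < q), I r s) =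
    conjSub (I q p) ⊔ (⨆ (r : ℤ) (_ : r < p) (s : ℤ) (_ : s < q), I r s)

open Classical in
/-- The subspaces `I^{p,q}_{(F,W)}` of the mixed Hodge structure `(F, W)`: its Deligne
bigrading, which is unique. (Value `⊥` if `(F, W)` is not a mixed Hodge structure.) -/
def deligneBigrading (F : ℤ → Submodule ℂ (ℂ ⊗[ℚ] H)) (W : ℤ → Submodule ℚ H) :
    ℤ → ℤ → Submodule ℂ (ℂ ⊗[ℚ] H) :=
  if h : ∃ I, IsDeligneBigrading F W I then h.choose else fun _ _ => ⊥

/-- `U^p = ⨁_q I^{p,q}_{(F,W)}`. -/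
def hodgeU (F : ℤ → Submodule ℂ (ℂ ⊗[ℚ] H)) (W : ℤ → Submodule ℚ H) (p : ℤ) :
    Submodule ℂ (ℂ ⊗[ℚ] H) :=
  ⨆ q, deligneBigrading F W p q

/-- `gl(V)_a`: the endomorphisms mapping `U^p` into `U^{p+a}` for all `p`. -/
def glGraded {V : Type u} [AddCommGroup V] [Module ℂ V] (U : ℤ → Submodule ℂ V) (a : ℤ) :
    Submodule ℂ (Module.End ℂ V) where
  carrier := {α | ∀ p, ∀ x ∈ U p, α x ∈ U (p + a)}
  zero_mem' := fun p x _ => by simp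
  add_mem' := fun h h' p x hx => by
    simpa using (U _).add_mem (h p x hx) (h' p x hx)
  smul_mem' := fun c α h p x hx => by
    simpa using (U _).smul_mem c (h p x hx)

/-- `β` is the component of degree `a` of `α` relative to `gl(V) = ⨁_b gl(V)_b`. -/
def IsComponent {V : Type u} [AddCommGroup V] [Module ℂ V] (U : ℤ → Submodule ℂ V) (a : ℤ)
    (α β : Module.End ℂ V) : Prop :=
  ∃ d : ℤ →₀ Module.End ℂ V, (∀ b, d b ∈ glGraded U b) ∧ (d.sum fun _ x => x) = α ∧ d a = β

/-- `ad γ : α ↦ γα - αγ` on `gl(V)`. -/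
def adEnd {V : Type u} [AddCommGroup V] [Module ℂ V] (γ : Module.End ℂ V) :
    Module.End ℂ (Module.End ℂ V) :=
  LinearMap.mulLeft ℂ γ - LinearMap.mulRight ℂ γ

/-- The component is unique when `V = ⨁ U^p`. -/
lemma IsComponent.unique {V : Type u} [AddCommGroup V] [Module ℂ V] {U : ℤ → Submodule ℂ V}
    (hU : DirectSum.IsInternal U) {a : ℤ} {α β β' : Module.End ℂ V}
    (h : IsComponent U a α β) (h' : IsComponent U a α β') : β = β' := by
  obtain ⟨d, hd, hs, rfl⟩ := h
  obtain ⟨d', hd', hs', rfl⟩ := h'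
  have key : ∀ p, ∀ x ∈ U p, d a x = d' a x := by
    intro p x hx
    have e : ∀ c : ℤ →₀ Module.End ℂ V, c.sum (fun _ y => y) = α →
        ∑ b ∈ d.support ∪ d'.support ∪ c.support, c b x = α x := by
      intro c hc
      rw [← hc, Finsupp.sum, LinearMap.sum_apply]
      refine (Finset.sum_subset Finset.subset_union_right ?_).symm
      intro b _ hb
      simp [Finsupp.notMem_support_iff.1 hb]
    have e1 := e d hs
    have e2 := e d' hs'
    have s1 : d.support ∪ d'.support ∪ d.support = d.support ∪ d'.support := by
      ext; simp; tauto
    have s2 : d.support ∪ d'.support ∪ d'.support = d.support ∪ d'.support := by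
      ext; simp
    rw [s1] at e1
    rw [s2] at e2
    have e3 : ∑ b ∈ d.support ∪ d'.support, (d b x - d' b x) = 0 := by
      rw [Finset.sum_sub_distrib, e1, e2, sub_self]
    have hind : iSupIndep fun b => U (p + b) :=
      hU.submodule_iSupIndep.comp (add_right_injective p)
    by_cases ha : a ∈ d.support ∪ d'.support
    · have hmem : ∀ b ∈ d.support ∪ d'.support, d b x - d' b x ∈ U (p + b) := fun b _ =>
        (U _).sub_mem (hd b p x hx) (hd' b p x hx)
      exact sub_eq_zero.1
        ((iSupIndep_iff_finsetSum_eq_zero_imp_eq_zero _).1 hind _ _ hmem e3 a ha)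
    · simp only [Finset.mem_union, not_or, Finsupp.notMem_support_iff] at ha
      simp [ha.1, ha.2]
  have top : (⊤ : Submodule ℂ V) ≤ LinearMap.eqLocus (d a) (d' a) := by
    rw [← hU.submodule_iSup_eq_top]
    exact iSup_le fun p x hx => key p x hx
  exact LinearMap.ext fun x => top (Submodule.mem_top : x ∈ ⊤)

/-- The logarithm `∑_{k ≥ 1} (-1)^{k+1} (g - 1)^k / k` of a unipotent endomorphism of a
finite dimensional vector space (the terms with `k > dim V` vanish). -/
def unipotentLog {K : Type*} [Field K] {V : Type u} [AddCommGroup V] [Module K V]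
    (g : Module.End K V) : Module.End K V :=
  ∑ k ∈ Finset.range (Module.finrank K V), ((-1 : K) ^ k / ((k : K) + 1)) • (g - 1) ^ (k + 1)

end LinearAlgebra

/-! ### Holomorphic maps into finite dimensional vector spaces, filtrations on open sets -/

section Holomorphic

variable {n : ℕ} {V : Type u} [AddCommGroup V] [Module ℂ V]

/-- A map from an open subset of `ℂⁿ` to a finite dimensional complex vector space (without
a chosen norm) is holomorphic if its coordinates are. -/
def IsHol (O : Set (Fin n → ℂ)) (f : (Fin n → ℂ) → V) : Prop :=
  ∀ l : Module.Dual ℂ V, DifferentiableOn ℂ (fun z => l (f z)) O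

/-- `w` is the partial derivative `∂f/∂z_j` at `z`. -/
def HasPartial (j : Fin n) (f : (Fin n → ℂ) → V) (z : Fin n → ℂ) (w : V) : Prop :=
  ∀ l : Module.Dual ℂ V, HasDerivAt (fun t => l (f (Function.update z j t))) (l w) (z j)

/-- The subspaces `F^p(z)`, `z ∈ O`, form holomorphic subbundles of `V × O`: locally, they have
holomorphic frames. -/
def IsHolomorphicFiltration {O : Set (Fin n → ℂ)} (F : ℤ → ↥O → Submodule ℂ V) : Prop :=
  ∀ (p : ℤ) (z₀ : ↥O), ∃ B : Set (Fin n → ℂ), IsOpen B ∧ ↑z₀ ∈ B ∧ B ⊆ O ∧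
    ∃ (d : ℕ) (e : Fin d → (Fin n → ℂ) → V), (∀ i, IsHol B (e i)) ∧
      ∀ z : ↥O, ↑z ∈ B → LinearIndependent ℂ (fun i => e i z) ∧
        Submodule.span ℂ (Set.range fun i => e i z) = F p z

/-- Griffiths horizontality: first derivatives of local holomorphic sections of `F^p` are
sections of `F^{p-1}`. -/
def IsHorizontal {O : Set (Fin n → ℂ)} (F : ℤ → ↥O → Submodule ℂ V) : Prop :=
  ∀ (p : ℤ) (B : Set (Fin n → ℂ)), IsOpen B → B ⊆ O → ∀ v : (Fin n → ℂ) → V, IsHol B v →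
    (∀ z : ↥O, ↑z ∈ B → v z ∈ F p z) →
      ∀ z : ↥O, ↑z ∈ B → ∀ (j : Fin n) (w : V), HasPartial j v z w → w ∈ F (p - 1) z

/-- The matrix valued 1-form `θ = ∑ θ_j ds_j` is a Higgs field on the product bundle
`V × O`: it is holomorphic and `θ ∧ θ = 0`, that is, `[θ_i, θ_j] = 0`. -/
def IsHiggsField (O : Set (Fin n → ℂ)) (θ : Fin n → (Fin n → ℂ) → Module.End ℂ V) : Prop :=
  (∀ j, IsHol O (θ j)) ∧ ∀ s ∈ O, ∀ i j, θ i s * θ j s - θ j s * θ i s = 0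

end Holomorphic

/-! ### The punctured polydisk and its universal covering -/

/-- The polydisk `Δⁿ_r`. -/
def polydisk (n : ℕ) (r : ℝ) : Set (Fin n → ℂ) := {s | ∀ j, ‖s j‖ < r}

/-- The punctured polydisk `Δ*ⁿ_r`. -/
def puncturedPolydisk (n : ℕ) (r : ℝ) : Set (Fin n → ℂ) := {s | ∀ j, s j ≠ 0 ∧ ‖s j‖ < r}

/-- The product `Uⁿ` of `n` upper half planes. -/
def upperHalf (n : ℕ) : Set (Fin n → ℂ) := {z | ∀ j, 0 < (z j).im}

/-- `s_j = e^{2πi z_j}`. -/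
def expMap {n : ℕ} (z : Fin n → ℂ) : Fin n → ℂ :=
  fun j => Complex.exp (2 * Real.pi * Complex.I * z j)

lemma norm_expMap {n : ℕ} (z : Fin n → ℂ) (j : Fin n) :
    ‖expMap z j‖ = Real.exp (-(2 * Real.pi * (z j).im)) := by
  simp [expMap, Complex.norm_exp]

lemma expMap_mem {n : ℕ} {z : Fin n → ℂ} (hz : z ∈ upperHalf n) :
    expMap z ∈ puncturedPolydisk n 1 := by
  intro j
  refine ⟨Complex.exp_ne_zero _, ?_⟩
  rw [norm_expMap, Real.exp_lt_one_iff]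
  have := mul_pos Real.two_pi_pos (hz j)
  linarith

/-- The covering map `Uⁿ → Δ*ⁿ`. -/
def cover {n : ℕ} (z : ↥(upperHalf n)) : ↥(puncturedPolydisk n 1) := ⟨expMap z, expMap_mem z.2⟩

lemma upperHalf_segment {n : ℕ} {z w : Fin n → ℂ} (hz : z ∈ upperHalf n) (hw : w ∈ upperHalf n)
    (t : unitInterval) : AffineMap.lineMap z w (t : ℂ) ∈ upperHalf n := by
  intro j
  have h : ((AffineMap.lineMap z w (t : ℂ) : Fin n → ℂ) j).im
      = (1 - (t : ℝ)) * (z j).im + (t : ℝ) * (w j).im := by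
    simp [AffineMap.lineMap_apply]
    ring
  rw [h]
  rcases eq_or_lt_of_le t.2.1 with h0 | h0
  · rw [← h0]; simpa using hz j
  · have h1 := mul_pos h0 (hw j)
    have h2 := mul_nonneg (sub_nonneg.2 t.2.2) (hz j).le
    linarith

/-- The path in `Δ*ⁿ` which is the image of the straight segment from `z` to `w` in `Uⁿ`. -/
def coverPath {n : ℕ} (z w : ↥(upperHalf n)) : Path (cover z) (cover w) where
  toFun t := cover ⟨AffineMap.lineMap (z : Fin n → ℂ) w ((t : ℝ) : ℂ), upperHalf_segment z.2 w.2 t⟩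
  continuous_toFun := by
    refine Continuous.subtype_mk ?_ _
    refine continuous_pi fun j => ?_
    simp only [expMap, AffineMap.lineMap_apply]
    fun_prop
  source' := by simp [cover]
  target' := by simp [cover]

/-- The counterclockwise loop `γ_j(t) = (s_1, …, e^{2πit} s_j, …, s_n)`. -/
def loop {n : ℕ} (s : ↥(puncturedPolydisk n 1)) (j : Fin n) : Path s s where
  toFun t := ⟨Function.update (s : Fin n → ℂ) j
      (Complex.exp (2 * Real.pi * Complex.I * (t : ℝ)) * (s : Fin n → ℂ) j), by
    intro i
    by_cases h : i = j
    · subst h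
      refine ⟨by simpa using (s.2 i).1, ?_⟩
      have : ‖Complex.exp (2 * Real.pi * Complex.I * (t : ℝ))‖ = 1 := by
        simp [Complex.norm_exp]
      simpa [this] using (s.2 i).2
    · simpa [Function.update_of_ne h] using s.2 i⟩
  continuous_toFun := by
    refine Continuous.subtype_mk ?_ _
    refine Continuous.update continuous_const j ?_
    fun_prop
  source' := by simp
  target' := by simp [Complex.exp_two_pi_mul_I]

/-- The base point `(i, …, i)` of `Uⁿ`. -/
def baseU (n : ℕ) : ↥(upperHalf n) := ⟨fun _ => Complex.I, fun _ => by simp⟩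

/-! ### Variations of graded-polarized mixed Hodge structure over `Δ*ⁿ` -/

open CategoryTheory

/-- A local system of `ℚ`-vector spaces on a space `X`: a representation of its
fundamental groupoid, by parallel translation. -/
abbrev LocalSystem (X : Type) [TopologicalSpace X] := FundamentalGroupoid X ⥤ ModuleCat.{u} ℚ

namespace LocalSystem

/-- The fibre at `x`. -/
abbrev fibre {X : Type} [TopologicalSpace X] (L : LocalSystem.{u} X) (x : X) : Type u :=
  L.obj (FundamentalGroupoid.mk x)

/-- Parallel translation along a path. -/
def transport {X : Type} [TopologicalSpace X] (L : LocalSystem.{u} X) {x y : X} (γ : Path x y) :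
    L.fibre x →ₗ[ℚ] L.fibre y :=
  (L.map (FundamentalGroupoid.fromPath (Path.Homotopic.Quotient.mk γ))).hom

/-- The space `V_ℚ` of flat multivalued sections over `Δ*ⁿ`, that is, of flat sections of the
pull back to the universal covering `Uⁿ`; a section is identified with its value at the
base point. The choice of the coordinates `s_j` identifies `V_ℚ` with the rational structure of
the central fibre of the canonical extension, via the single valued sections
`σᶜ = e^{∑ z_j N_j} σ`. -/
abbrev VQ {n : ℕ} (L : LocalSystem.{u} ↥(puncturedPolydisk n 1)) : Type u :=
  L.fibre (cover (baseU n))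

/-- `V = V_ℚ ⊗ ℂ`. -/
abbrev VC {n : ℕ} (L : LocalSystem.{u} ↥(puncturedPolydisk n 1)) : Type u := ℂ ⊗[ℚ] L.VQ

/-- Parallel translation to `V` of a family of subspaces of the fibres: the subspace of the
`σ ∈ V` whose value at `z` lies in the given subspace over `e^{2πiz}`. -/
def develop {n : ℕ} (L : LocalSystem.{u} ↥(puncturedPolydisk n 1))
    (F : ∀ s, ℤ → Submodule ℂ (ℂ ⊗[ℚ] L.fibre s)) (p : ℤ) (z : ↥(upperHalf n)) :
    Submodule ℂ L.VC :=
  (F (cover z) p).map ((L.transport (coverPath z (baseU n))).baseChange ℂ)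

end LocalSystem

/-- A variation of graded-polarized mixed Hodge structure over `Δ*ⁿ`. Holomorphy and
horizontality are local conditions, expressed on the universal covering `Uⁿ`, where parallel
translation trivializes the local system. -/
structure VGPMHS (n : ℕ) where
  /-- the local system `𝒱_ℚ` -/
  L : LocalSystem.{u} ↥(puncturedPolydisk n 1)
  finite : ∀ s, Module.Finite ℚ (L.fibre s)
  /-- the weight filtration, by sub-local systems -/
  W : ∀ s, ℤ → Submodule ℚ (L.fibre s)
  weight_filtration : ∀ s, IsWeightFiltration (W s)
  weight_flat : ∀ {s t} (γ : Path s t) (k), (W s k).map (L.transport γ) ≤ W t k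
  /-- the Hodge filtration -/
  F : ∀ s, ℤ → Submodule ℂ (ℂ ⊗[ℚ] L.fibre s)
  hodge_filtration : ∀ s, IsHodgeFiltration (F s)
  hodge_holomorphic : IsHolomorphicFiltration (L.develop F)
  hodge_horizontal : IsHorizontal (L.develop F)
  /-- the flat bilinear forms on `Gr^W_k` -/
  S : ∀ s k, LinearMap.BilinForm ℚ (Gr (W s) k)
  form_flat : ∀ {s t} (γ : Path s t) (k) (u v : ↥(W s k)) (u' v' : ↥(W t k)),
    L.transport γ u = u' → L.transport γ v = v' →
      S t k (toGr (W t) k u') (toGr (W t) k v') = S s k (toGr (W s) k u) (toGr (W s) k v)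
  /-- `F Gr^W_k` is a variation of pure Hodge structure of weight `k` polarized by `S_k` -/
  graded_polarized : ∀ s k, IsPolarizedHodge k (grF (W s) (F s) k) (S s k)
  graded_holomorphic : ∀ k, IsHolomorphicFiltration
    (fun p z => grF (W (cover (baseU n))) (fun p => L.develop F p z) k p)
  graded_horizontal : ∀ k, IsHorizontal
    (fun p z => grF (W (cover (baseU n))) (fun p => L.develop F p z) k p)

namespace VGPMHS

variable {n : ℕ} (𝒱 : VGPMHS.{u} n)

/-- The rational vector space `V_ℚ`. -/
abbrev VQ : Type u := 𝒱.L.VQ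

/-- The complex vector space `V = V_ℚ ⊗ ℂ`. -/
abbrev V : Type u := 𝒱.L.VC

/-- The weight filtration of `V_ℚ`. -/
abbrev WV : ℤ → Submodule ℚ 𝒱.VQ := 𝒱.W (cover (baseU n))

/-- The bilinear forms on `Gr^W_k V_ℚ`. -/
abbrev SV : ∀ k, LinearMap.BilinForm ℚ (Gr 𝒱.WV k) := 𝒱.S (cover (baseU n))

/-- The period map `F(z)` on `Uⁿ`. -/
abbrev period : ℤ → ↥(upperHalf n) → Submodule ℂ 𝒱.V := 𝒱.L.develop 𝒱.F

/-- The monodromy `T_j`: parallel translation along `γ_j`. -/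
def T (j : Fin n) : Module.End ℚ 𝒱.VQ := 𝒱.L.transport (loop (cover (baseU n)) j)

/-- The monodromy is unipotent. -/
def HasUnipotentMonodromy : Prop := ∀ j, IsNilpotent (𝒱.T j - 1)

/-- `N_j = -log T_j`, over `ℚ`. -/
def NQ (j : Fin n) : Module.End ℚ 𝒱.VQ := -unipotentLog (𝒱.T j)

/-- `N_j = -log T_j`, acting on `V`. -/
def N (j : Fin n) : Module.End ℂ 𝒱.V := (𝒱.NQ j).baseChange ℂ

end VGPMHS

/-! ### Infinitesimal mixed Hodge modules and admissibility -/

/-- The data `(W, S, F, N_1, …, N_n)` form an infinitesimal mixed Hodge module. -/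
structure IsIMHM {n : ℕ} {H : Type u} [AddCommGroup H] [Module ℚ H]
    (W : ℤ → Submodule ℚ H) (S : ∀ k, LinearMap.BilinForm ℚ (Gr W k))
    (F : ℤ → Submodule ℂ (ℂ ⊗[ℚ] H)) (N : Fin n → Module.End ℚ H) : Prop where
  weight_filtration : IsWeightFiltration W
  hodge_filtration : IsHodgeFiltration F
  commute : ∀ i j, Commute (N i) (N j)
  nilpotent : ∀ j, IsNilpotent (N j)
  hodge_shift : ∀ j p, (F p).map ((N j).baseChange ℂ) ≤ F (p - 1)
  /-- `N_j` preserves `W` and acts on `Gr^W_k` by infinitesimal isometries of `S_k` -/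
  isometry : ∀ j, (N j).baseChange ℂ ∈ lieG W S
  /-- on `Gr^W_k`, the data define a nilpotent orbit of weight `k` polarized by `S_k` -/
  orbit : ∀ k, ∃ c : ℝ, ∀ z : Fin n → ℂ, (∀ j, c < (z j).im) →
    IsPolarizedHodge k
      (grF W (fun p => (F p).map (IsNilpotent.exp (∑ j, z j • (N j).baseChange ℂ))) k) (S k)
  /-- existence of the relative weight filtrations of `N_J = ∑_{j ∈ J} N_j` -/
  relative : ∀ J : Finset (Fin n), ∃ M, IsRelativeWeight (∑ j ∈ J, N j) W M
  relative_shift : ∀ (J : Finset (Fin n)), ∀ j ∈ J, ∀ k,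
    (relativeWeight (∑ j ∈ J, N j) W k).map (N j) ≤ relativeWeight (∑ j ∈ J, N j) W (k - 2)

namespace VGPMHS

variable {n : ℕ} (𝒱 : VGPMHS.{u} n)

/-- `e^{∑ z_j N_j}`. -/
def expN (z : Fin n → ℂ) : Module.End ℂ 𝒱.V := IsNilpotent.exp (∑ j, z j • 𝒱.N j)

/-- The variation `𝒱` (with unipotent monodromy) is admissible, with extended untwisted
period map `ψ`. The relation `F(z) = e^{∑ z_j N_j} ψ(e^{2πiz})` says that, over `Δ*ⁿ`, the
filtration `ψ(s)` is the Hodge filtration of `𝒱` at `s`, transported by the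
connection `∇ᶜ`. -/
structure IsAdmissible (ψ : ℤ → (Fin n → ℂ) → Submodule ℂ 𝒱.V) : Prop where
  unipotent : 𝒱.HasUnipotentMonodromy
  untwist : ∀ p (z : ↥(upperHalf n)), 𝒱.period p z = (ψ p (expMap z)).map (𝒱.expN z)
  /-- `ψ` is holomorphic on `Δⁿ` -/
  holomorphic : IsHolomorphicFiltration (O := polydisk n 1) (fun p s => ψ p s)
  /-- `ψ` takes its values in the compact dual of the classifying space -/
  filtration : ∀ s ∈ polydisk n 1, IsHodgeFiltration (fun p => ψ p s)
  hodge_numbers : ∀ s ∈ polydisk n 1, ∀ k p,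
    Module.finrank ℂ (grF 𝒱.WV (fun p => ψ p s) k p) =
      Module.finrank ℂ (grF 𝒱.WV (fun p => 𝒱.period p (baseU n)) k p)
  orthogonal : ∀ s ∈ polydisk n 1, ∀ k p,
    ∀ u ∈ grF 𝒱.WV (fun p => ψ p s) k p, ∀ v ∈ grF 𝒱.WV (fun p => ψ p s) k (k + 1 - p),
      ((𝒱.SV k).baseChange ℂ) u v = 0
  /-- the limiting data with `F_∞ = ψ(0)` form an infinitesimal mixed Hodge module -/
  imhm : IsIMHM 𝒱.WV 𝒱.SV (fun p => ψ p 0) 𝒱.NQ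

/-- The relative weight filtration `ʳW` of the monodromy cone, computed at the element
`N_1 + ⋯ + N_n` of the cone. -/
def relW : ℤ → Submodule ℚ 𝒱.VQ := relativeWeight (∑ j, 𝒱.NQ j) 𝒱.WV

/-- `U^p_∞ = ⨁_q I^{p,q}_{(F_∞, ʳW)}`, for a filtration `F_∞` of `V`. -/
def UInf (Finf : ℤ → Submodule ℂ 𝒱.V) : ℤ → Submodule ℂ 𝒱.V := hodgeU Finf 𝒱.relW

/-- `℘_a`: the elements of `Lie(G_ℂ)` mapping `U^p_∞` into `U^{p+a}_∞` for all `p`. -/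
def wp (Finf : ℤ → Submodule ℂ 𝒱.V) (a : ℤ) : Submodule ℂ (Module.End ℂ 𝒱.V) :=
  lieG 𝒱.WV 𝒱.SV ⊓ glGraded (𝒱.UInf Finf) a

/-- `q_∞ = ⨁_{a < 0} ℘_a`. -/
def qInf (Finf : ℤ → Submodule ℂ 𝒱.V) : Submodule ℂ (Module.End ℂ 𝒱.V) :=
  ⨆ (a : ℤ) (_ : a < 0), 𝒱.wp Finf a

/-- `Γ : Δⁿ_r → q_∞` is holomorphic, vanishes at `0` and satisfies `ψ(s) = e^{Γ(s)}.F_∞`, where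
`F_∞ = ψ(0)`. -/
structure IsPeriodLog (ψ : ℤ → (Fin n → ℂ) → Submodule ℂ 𝒱.V) (r : ℝ)
    (Γ : (Fin n → ℂ) → Module.End ℂ 𝒱.V) : Prop where
  holomorphic : IsHol (polydisk n r) Γ
  zero : Γ 0 = 0
  mem : ∀ s ∈ polydisk n r, Γ s ∈ 𝒱.qInf (fun p => ψ p 0)
  eq : ∀ s ∈ polydisk n r, ∀ p, ψ p s = (ψ p 0).map (IsNilpotent.exp (Γ s))

/-- The coefficient `Ω_j = N_j / (2πi s_j)` of `Ω = (1/2πi) ∑ ds_j/s_j ⊗ N_j`. -/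
def Omega (j : Fin n) (s : Fin n → ℂ) : Module.End ℂ 𝒱.V :=
  (2 * Real.pi * Complex.I * s j)⁻¹ • 𝒱.N j

/-- `X(z) = log(e^{∑ z_j N_j} e^{Γ(s)})`, `s = e^{2πiz}`. -/
def X (Γ : (Fin n → ℂ) → Module.End ℂ 𝒱.V) (z : Fin n → ℂ) : Module.End ℂ 𝒱.V :=
  unipotentLog (𝒱.expN z * IsNilpotent.exp (Γ (expMap z)))

end VGPMHS

end

/-! Put g(z) = e^{∑ z_j N_j} e^{Γ(s)}, so that F(z) = g(z).F_∞. By the product rule g⁻¹∂g is the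
pullback of ω = e^{-ad Γ} Ω + e^{-Γ} ∂e^Γ (`hasPartial_frame`). Two constraints on ω meet. Griffiths
horizontality, applied to the sections g(z)x with x ∈ F_∞^p, says that ω maps F_∞^p into F_∞^{p-1}
(`logForm_map_hodge`). On the other hand N_j and Γ take values in the Lie algebra q_∞, hence so does
ω (`logForm_mem_qInf`). As F_∞^p is the sum of the U^r with r ≥ p, an element of negative degree
that lowers F_∞ by at most one step has degree exactly -1 (`mem_glGraded_of_mem_negPart`), so ω is
℘_{-1}-valued. That N_j itself has degree -1 comes from Deligne's description of I^{p,q}: N_j is a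
morphism of type (-1,-1) of the limiting mixed Hodge structure (`IsDeligneBigrading.map_mem`).

Modulo degree ≤ -2, products of elements of negative degree disappear, so exponentials, logarithms
and e^{-ad Γ} become linear. Comparing terms of degree -1 gives ω = Ω + ∂Γ_{-1} and X_{-1} = ∑ z_j
N_j + Γ_{-1}, hence the pullback of ω is ∂X_{-1}. Now ω pulls back both to an exact form and to
g⁻¹∂g, which satisfies the Maurer-Cartan equation; therefore ω ∧ ω = 0. Concretely, this compares
the two mixed second derivatives of g (`logForm_commute`).

The bigrading is ⊥ by convention when no Deligne bigrading exists. Its existence is not derived; in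
the other case every degree condition is vacuous and Γ_{-1} = 0 serves. -/

/-! ### Projections of a graded module -/

section GradedProjection

variable {ι R M : Type*} [DecidableEq ι] [Ring R] [AddCommGroup M] [Module R M]
  {A : ι → Submodule R M}

/-- The isomorphism of `⨁ i, A i` with `M`. -/
noncomputable def internalEquiv (hA : DirectSum.IsInternal A) : (DirectSum ι fun i => A i) ≃ₗ[R] M :=
  LinearEquiv.ofBijective (DirectSum.coeLinearMap A)
    (show Function.Bijective (DirectSum.coeLinearMap A) from hA)

lemma internalEquiv_apply (hA : DirectSum.IsInternal A) (x : DirectSum ι fun i => A i) :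
    internalEquiv hA x = DirectSum.coeLinearMap A x := rfl

lemma internalEquiv_symm_of_mem (hA : DirectSum.IsInternal A) {i : ι} {x : M} (hx : x ∈ A i) :
    (internalEquiv hA).symm x = DirectSum.lof R ι (fun i => A i) i ⟨x, hx⟩ := by
  rw [LinearEquiv.symm_apply_eq, internalEquiv_apply, DirectSum.coeLinearMap_lof]

/-- The projection to the `i`-th summand of an internal direct sum. -/
noncomputable def gradedProj (hA : DirectSum.IsInternal A) (i : ι) : M →ₗ[R] M :=
  (A i).subtype ∘ₗ DirectSum.component R ι (fun i => A i) i ∘ₗ (internalEquiv hA).symm.toLinearMap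

lemma gradedProj_apply (hA : DirectSum.IsInternal A) (i : ι) (x : M) :
    gradedProj hA i x = (internalEquiv hA).symm x i := rfl

lemma gradedProj_mem (hA : DirectSum.IsInternal A) (i : ι) (x : M) : gradedProj hA i x ∈ A i :=
  Subtype.property _

lemma gradedProj_same (hA : DirectSum.IsInternal A) {i : ι} {x : M} (hx : x ∈ A i) :
    gradedProj hA i x = x := by
  rw [gradedProj_apply, internalEquiv_symm_of_mem hA hx, DirectSum.lof_apply]

lemma gradedProj_ne (hA : DirectSum.IsInternal A) {i j : ι} (hij : i ≠ j) {x : M}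
    (hx : x ∈ A i) : gradedProj hA j x = 0 := by
  rw [gradedProj_apply, internalEquiv_symm_of_mem hA hx, DirectSum.lof_eq_of,
    DirectSum.of_eq_of_ne _ _ _ hij.symm, ZeroMemClass.coe_zero]

lemma eq_sum_gradedProj (hA : DirectSum.IsInternal A) (x : M) :
    ∃ s : Finset ι, x = ∑ i ∈ s, gradedProj hA i x := by
  classical
  refine ⟨((internalEquiv hA).symm x).support, ?_⟩
  conv_lhs => rw [← (internalEquiv hA).apply_symm_apply x]
  rw [internalEquiv_apply, DirectSum.coeLinearMap_eq_dfinsuppSum]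
  rfl

lemma mem_biSup_iff_gradedProj (hA : DirectSum.IsInternal A) (S : Set ι) (x : M) :
    x ∈ ⨆ i ∈ S, A i ↔ ∀ j ∉ S, gradedProj hA j x = 0 := by
  classical
  constructor
  · intro hx j hj
    have : (⨆ i ∈ S, A i) ≤ LinearMap.ker (gradedProj hA j) :=
      iSup₂_le fun i hi y hy => gradedProj_ne hA (by rintro rfl; exact hj hi) hy
    exact this hx
  · intro h
    obtain ⟨s, hs⟩ := eq_sum_gradedProj hA x
    rw [hs]
    refine Submodule.sum_mem _ fun i _ => ?_
    by_cases hi : i ∈ S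
    · exact Submodule.mem_iSup_of_mem i (Submodule.mem_iSup_of_mem hi (gradedProj_mem hA i x))
    · rw [h i hi]; exact Submodule.zero_mem _

end GradedProjection

/-! ### Morphisms of mixed Hodge structures and the Deligne bigrading -/

section Deligne

variable {H : Type u} [AddCommGroup H] [Module ℚ H]

lemma conjC_conjC (x : ℂ ⊗[ℚ] H) : conjC (conjC x) = x := by
  induction x using TensorProduct.induction_on with
  | zero => simp
  | tmul a h => simp [conjC]
  | add x y hx hy => rw [map_add, map_add, hx, hy]

lemma baseChange_conjC (f : Module.End ℚ H) (x : ℂ ⊗[ℚ] H) :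
    f.baseChange ℂ (conjC x) = conjC (f.baseChange ℂ x) := by
  induction x using TensorProduct.induction_on with
  | zero => simp
  | tmul a h => simp [conjC]
  | add x y hx hy => rw [map_add, map_add, map_add, map_add, hx, hy]

namespace IsDeligneBigrading

variable {F : ℤ → Submodule ℂ (ℂ ⊗[ℚ] H)} {W : ℤ → Submodule ℚ H}
  {I : ℤ → ℤ → Submodule ℂ (ℂ ⊗[ℚ] H)}

/-- The sum of the `I^{p,q}` with `(p,q)` in a given set. -/
noncomputable def part (I : ℤ → ℤ → Submodule ℂ (ℂ ⊗[ℚ] H)) (S : Set (ℤ × ℤ)) : Submodule ℂ (ℂ ⊗[ℚ] H) :=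
  ⨆ i ∈ S, I i.1 i.2

lemma le_part {S : Set (ℤ × ℤ)} {p q : ℤ} (h : (p, q) ∈ S) : I p q ≤ part I S :=
  le_iSup₂_of_le (f := fun (i : ℤ × ℤ) (_ : i ∈ S) => I i.1 i.2) (p, q) h le_rfl

lemma part_le {S : Set (ℤ × ℤ)} {E : Submodule ℂ (ℂ ⊗[ℚ] H)}
    (h : ∀ p q, (p, q) ∈ S → I p q ≤ E) : part I S ≤ E :=
  iSup₂_le fun i hi => h i.1 i.2 hi

lemma hodge_eq_part (hI : IsDeligneBigrading F W I) (p : ℤ) : F p = part I {i | p ≤ i.1} := by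
  rw [hI.hodge]
  refine le_antisymm (iSup_le fun r => iSup_le fun hr => iSup_le fun s => le_part hr) ?_
  exact part_le fun r s hr => le_iSup_of_le r (le_iSup_of_le hr (le_iSup_of_le s le_rfl))

lemma weight_eq_part (hI : IsDeligneBigrading F W I) (k : ℤ) :
    (W k).baseChange ℂ = part I {i | i.1 + i.2 ≤ k} := by
  rw [hI.weight]
  refine le_antisymm (iSup_le fun r => iSup_le fun s => iSup_le fun hr => le_part hr) ?_
  exact part_le fun r s hr => le_iSup_of_le r (le_iSup_of_le s (le_iSup_of_le hr le_rfl))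

lemma conjC_mem (hI : IsDeligneBigrading F W I) {p q : ℤ} {x : ℂ ⊗[ℚ] H} (hx : x ∈ I p q) :
    conjC x ∈ part I {i | i = (q, p) ∨ (i.1 < q ∧ i.2 < p)} := by
  have h1 : conjC x ∈ conjSub (I p q) := by
    change conjC (conjC x) ∈ I p q
    rwa [conjC_conjC]
  have h2 := Submodule.mem_sup_left
    (T := ⨆ (r : ℤ) (_ : r < q) (s : ℤ) (_ : s < p), I r s) h1
  rw [← hI.conj q p] at h2
  refine (sup_le (le_part (Or.inl rfl)) ?_ : _ ≤ part I _) h2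
  exact iSup_le fun r => iSup_le fun hr => iSup_le fun s => iSup_le fun hs =>
    le_part (Or.inr ⟨hr, hs⟩)

lemma part_mono {S T : Set (ℤ × ℤ)} (h : S ⊆ T) : part I S ≤ part I T :=
  part_le fun _ _ hi => le_part (h hi)

lemma conjC_mem_part (hI : IsDeligneBigrading F W I) {p q : ℤ} {x : ℂ ⊗[ℚ] H}
    (hx : x ∈ part I {i | i.1 < p ∧ i.2 < q}) :
    conjC x ∈ part I {i | i.1 < q ∧ i.2 < p} := by
  have : part I {i | i.1 < p ∧ i.2 < q} ≤ (part I {i | i.1 < q ∧ i.2 < p}).comap conjC := by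
    refine part_le fun r s hrs y hy => ?_
    refine part_mono ?_ (hI.conjC_mem hy)
    rintro ⟨a, b⟩ (h | ⟨h1, h2⟩)
    · obtain ⟨rfl, rfl⟩ := Prod.mk.inj h
      exact ⟨hrs.2, hrs.1⟩
    · exact ⟨lt_trans h1 hrs.2, lt_trans h2 hrs.1⟩
  exact this hx

lemma mem_part (hI : IsDeligneBigrading F W I) {S : Set (ℤ × ℤ)} {x : ℂ ⊗[ℚ] H} :
    x ∈ part I S ↔ ∀ i ∉ S, gradedProj hI.internal i x = 0 :=
  mem_biSup_iff_gradedProj hI.internal S x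

/-- Deligne's description of `I^{p,q}`. -/
lemma mem_of_conjC_mem (hI : IsDeligneBigrading F W I) {p q : ℤ} {x : ℂ ⊗[ℚ] H}
    (hF : x ∈ F p) (hW : x ∈ (W (p + q)).baseChange ℂ)
    (hc : conjC x ∈ part I {i | q ≤ i.1 ∨ i.2 < p}) : x ∈ I p q := by
  rw [hI.hodge_eq_part, hI.mem_part] at hF
  rw [hI.weight_eq_part, hI.mem_part] at hW
  rw [hI.mem_part] at hc
  -- Descending induction on the weight i.1 + i.2, starting above p + q where the weight condition
  -- kills everything.
  have key : ∀ m : ℕ, ∀ i : ℤ × ℤ, i ≠ (p, q) → p + q < i.1 + i.2 + m →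
      gradedProj hI.internal i x = 0 := by
    intro m
    induction m with
    | zero => exact fun i _ hi => hW i (by simp only [Set.mem_ofPred_eq]; omega)
    | succ m ih =>
      rintro ⟨r, s⟩ hne hi
      by_cases hi' : p + q < r + s + m
      · exact ih _ hne hi'
      by_cases hr : p ≤ r
      swap
      · exact hF _ hr
      have hs : s < q := by
        -- The weight r + s is now exactly p + q - m ≤ p + q, so p ≤ r and (r, s) ≠ (p, q) leave
        -- only s < q.
        push_cast at hi
        rcases lt_trichotomy s q with h | h | h
        · exact h
        · exact absurd (Prod.ext (by simp only; omega) h : ((r, s) : ℤ × ℤ) = (p, q)) hne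
        · omega
      set y := gradedProj hI.internal (r, s) x with hy
      have hyI : y ∈ I r s := gradedProj_mem hI.internal (r, s) x
      -- the `(s, r)`-component of `conj x` only comes from `y`
      have h1 : gradedProj hI.internal (s, r) (conjC x) =
          gradedProj hI.internal (s, r) (conjC y) := by
        obtain ⟨S, hS⟩ := eq_sum_gradedProj hI.internal x
        have hz : ∀ i ∈ S, i ≠ (r, s) →
            gradedProj hI.internal (s, r) (conjC (gradedProj hI.internal i x)) = 0 := by
          rintro ⟨a, b⟩ - hab
          by_cases h : ((a, b) : ℤ × ℤ) = (p, q)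
          · obtain ⟨rfl, rfl⟩ := Prod.mk.inj h
            refine hI.mem_part.1 (hI.conjC_mem (gradedProj_mem hI.internal (a, b) x)) _ ?_
            rintro (h' | h')
            · have := (Prod.mk.inj h').1; omega
            · simp only at h'; omega
          by_cases h' : p + q < a + b + m
          · rw [ih _ h h', map_zero, map_zero]
          refine hI.mem_part.1 (hI.conjC_mem (gradedProj_mem hI.internal (a, b) x)) _ ?_
          rintro (h'' | h'')
          · obtain ⟨rfl, rfl⟩ := Prod.mk.inj h''
            exact hab rfl
          · simp only at h''
            push_cast at hi
            omega
        by_cases hmem : (r, s) ∈ S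
        · conv_lhs => rw [hS]
          rw [map_sum, map_sum, Finset.sum_eq_single_of_mem _ hmem hz]
        · have hy0 : y = 0 := by
            rw [hy, hS, map_sum]
            refine Finset.sum_eq_zero fun i hi => gradedProj_ne hI.internal ?_
              (gradedProj_mem hI.internal i x)
            exact fun h => hmem (h ▸ hi)
          rw [hy0, map_zero, map_zero]
          conv_lhs => rw [hS]
          rw [map_sum, map_sum]
          exact Finset.sum_eq_zero fun i hi => hz i hi fun h => hmem (h ▸ hi)
      -- Since s < q and p ≤ r, the index (s, r) is excluded by `hc`. So conj y has only terms
      -- strictly below (s, r), and conjugating back puts y strictly below (r, s), although y ∈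
      -- I^{r,s}.
      have h2 : gradedProj hI.internal (s, r) (conjC x) = 0 := hc _ (by
        simp only [Set.mem_ofPred_eq]; omega)
      have h3 : conjC y ∈ part I {i | i.1 < s ∧ i.2 < r} := by
        rw [hI.mem_part]
        intro i hi
        by_cases h : i = (s, r)
        · rw [h, ← h1, h2]
        · exact hI.mem_part.1 (hI.conjC_mem hyI) i (by
            rintro (h' | h')
            · exact h h'
            · exact hi h')
      have h4 := hI.conjC_mem_part h3
      rw [conjC_conjC, hI.mem_part] at h4
      have h5 := h4 (r, s) (by simp)
      rwa [gradedProj_same hI.internal hyI] at h5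
  have : x ∈ part I {(p, q)} := hI.mem_part.2 fun i hi => key (p + q + 1 - (i.1 + i.2)).toNat i hi
    (by have := Int.self_le_toNat (p + q + 1 - (i.1 + i.2)); omega)
  simpa [part] using this

/-- A rational endomorphism shifting `F` by `-1` and `W` by `-2` is a morphism of mixed Hodge
structures of type `(-1,-1)`, hence shifts the Deligne bigrading by `(-1,-1)`. -/
lemma map_mem (hI : IsDeligneBigrading F W I) {f : Module.End ℚ H}
    (hF : ∀ p, (F p).map (f.baseChange ℂ) ≤ F (p - 1))
    (hW : ∀ k, (W k).map f ≤ W (k - 2)) {p q : ℤ} {x : ℂ ⊗[ℚ] H} (hx : x ∈ I p q) :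
    f.baseChange ℂ x ∈ I (p - 1) (q - 1) := by
  have hWC : ∀ k, ∀ y ∈ (W k).baseChange ℂ, f.baseChange ℂ y ∈ (W (k - 2)).baseChange ℂ := by
    intro k y hy
    have : ((W k).baseChange ℂ).map (f.baseChange ℂ) ≤ (W (k - 2)).baseChange ℂ := by
      rw [Submodule.baseChange_eq_span, Submodule.map_span, Submodule.span_le]
      rintro _ ⟨_, ⟨w, hw, rfl⟩, rfl⟩
      simpa using Submodule.tmul_mem_baseChange_of_mem (1 : ℂ) (hW k ⟨w, hw, rfl⟩)
    exact this ⟨y, hy, rfl⟩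
  have hFI : ∀ r s, ∀ y ∈ I r s, f.baseChange ℂ y ∈ F (r - 1) := fun r s y hy =>
    hF r ⟨y, by rw [hI.hodge_eq_part]; exact le_part (le_refl r) hy, rfl⟩
  have hWI : ∀ r s, ∀ y ∈ I r s, f.baseChange ℂ y ∈ (W (r + s - 2)).baseChange ℂ := fun r s y hy =>
    hWC _ y (by rw [hI.weight_eq_part]; exact le_part (le_refl (r + s)) hy)
  refine hI.mem_of_conjC_mem (hFI p q x hx) ?_ ?_
  · have := hWI p q x hx
    rwa [show p + q - 2 = p - 1 + (q - 1) by ring] at this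
  rw [← baseChange_conjC]
  -- On I^{r,s} the image has components (a, b) with a ≥ r - 1 and a + b ≤ r + s - 2 only. For (r,
  -- s) = (q, p) this gives a ≥ q - 1; for r < q, s < p it gives b ≤ s - 1 < p - 1.
  have hle : part I {i | i = (q, p) ∨ (i.1 < q ∧ i.2 < p)} ≤
      (part I {i | q - 1 ≤ i.1 ∨ i.2 < p - 1}).comap (f.baseChange ℂ) := by
    refine part_le fun r s hrs y hy => ?_
    have h1 := hFI r s y hy
    have h2 := hWI r s y hy
    rw [hI.hodge_eq_part, hI.mem_part] at h1
    rw [hI.weight_eq_part, hI.mem_part] at h2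
    rw [Submodule.mem_comap, hI.mem_part]
    rintro ⟨a, b⟩ hab
    simp only [Set.mem_ofPred_eq, not_or, not_le, not_lt] at hab
    by_cases ha : r - 1 ≤ a
    · refine h2 _ ?_
      simp only [Set.mem_ofPred_eq]
      rcases hrs with h | h
      · obtain ⟨rfl, rfl⟩ := Prod.mk.inj h
        omega
      · simp only at h; omega
    · exact h1 _ ha
  exact hle (hI.conjC_mem hx)

end IsDeligneBigrading

end Deligne

/-- The exponential of a nilpotent element of a complex algebra. -/
lemma exp_eq_sum_complex {A : Type*} [Ring A] [Algebra ℂ A] [Module ℚ A] {a : A} {k : ℕ}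
    (h : a ^ k = 0) :
    IsNilpotent.exp a = ∑ i ∈ Finset.range k, ((i.factorial : ℂ)⁻¹) • a ^ i := by
  rw [IsNilpotent.exp_eq_sum h]
  -- The scalars 1/i! act identically over ℚ and ℂ for any `ℚ`-module structure, which is why that
  -- instance can stay arbitrary.
  exact Finset.sum_congr rfl fun i _ => inv_natCast_smul_eq ℚ ℂ i.factorial (a ^ i)

/-! ### The grading of `gl(V)` -/

section GradedEnd

variable {V : Type u} [AddCommGroup V] [Module ℂ V] {U : ℤ → Submodule ℂ V}

lemma mul_mem_glGraded {a b : ℤ} {α β : Module.End ℂ V} (hα : α ∈ glGraded U a)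
    (hβ : β ∈ glGraded U b) : α * β ∈ glGraded U (a + b) := fun p x hx => by
  have := hα _ _ (hβ p x hx)
  rwa [show p + b + a = p + (a + b) by ring] at this

lemma one_mem_glGraded : (1 : Module.End ℂ V) ∈ glGraded U 0 := fun p x hx => by
  simpa using hx

/-- The sum of the `gl(V)_a` with `a ≤ c`. -/
def glBelow (U : ℤ → Submodule ℂ V) (c : ℤ) : Submodule ℂ (Module.End ℂ V) :=
  ⨆ (a : ℤ) (_ : a ≤ c), glGraded U a

lemma glGraded_le_glBelow {a c : ℤ} (h : a ≤ c) : glGraded U a ≤ glBelow U c :=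
  le_iSup₂_of_le (f := fun a (_ : a ≤ c) => glGraded U a) a h le_rfl

lemma glBelow_le {c : ℤ} {E : Submodule ℂ (Module.End ℂ V)} (h : ∀ a ≤ c, glGraded U a ≤ E) :
    glBelow U c ≤ E := iSup₂_le h

lemma glBelow_mono {c d : ℤ} (h : c ≤ d) : glBelow U c ≤ glBelow U d :=
  glBelow_le fun _ ha => glGraded_le_glBelow (ha.trans h)

/-- Multiplicativity of the degree filtration is what makes products of two elements of degree ≤ -1
negligible modulo degree ≤ -2; all first order computations below rest on it. -/
lemma mul_mem_glBelow {c d : ℤ} {α β : Module.End ℂ V} (hα : α ∈ glBelow U c)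
    (hβ : β ∈ glBelow U d) : α * β ∈ glBelow U (c + d) := by
  have h1 : glBelow U c ≤ (glBelow U (c + d)).comap (LinearMap.mulRight ℂ β) := by
    refine glBelow_le fun a ha α hα => ?_
    have h2 : glBelow U d ≤ (glBelow U (c + d)).comap (LinearMap.mulLeft ℂ α) :=
      glBelow_le fun b hb β hβ =>
        glGraded_le_glBelow (add_le_add ha hb) (mul_mem_glGraded hα hβ)
    exact h2 hβ
  exact h1 hα

lemma pow_mem_glBelow {α : Module.End ℂ V} (hα : α ∈ glBelow U (-1)) (k : ℕ) :
    α ^ k ∈ glBelow U (-k) := by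
  induction k with
  | zero => simpa using glGraded_le_glBelow le_rfl one_mem_glGraded
  | succ k ih =>
    have := mul_mem_glBelow ih hα
    rw [pow_succ]
    convert this using 2
    push_cast
    ring

lemma exp_sub_one_sub_mem_glBelow [Module ℚ (Module.End ℂ V)] {α : Module.End ℂ V}
    (hα : α ∈ glBelow U (-1))
    (hn : IsNilpotent α) : IsNilpotent.exp α - 1 - α ∈ glBelow U (-2) := by
  obtain ⟨k, hk⟩ := hn
  -- Padding the exponent to k + 2 guarantees that the terms of order 0 and 1 are present and can be
  -- split off.
  rw [exp_eq_sum_complex (pow_eq_zero_of_le (Nat.le_add_right k 2) hk),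
    Finset.sum_range_succ', Finset.sum_range_succ']
  have : (∑ i ∈ Finset.range k, ((i + 1 + 1).factorial : ℂ)⁻¹ • α ^ (i + 1 + 1)) ∈
      glBelow U (-2) := by
    refine Submodule.sum_mem _ fun i _ => ?_
    refine Submodule.smul_mem _ _ ?_
    exact glBelow_mono (by push_cast; omega) (pow_mem_glBelow hα (i + 1 + 1))
  convert this using 1
  simp

lemma unipotentLog_sub_mem_glBelow {g : Module.End ℂ V} [Module.Finite ℂ V]
    (hg : g - 1 ∈ glBelow U (-1)) : unipotentLog g - (g - 1) ∈ glBelow U (-2) := by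
  -- In dimension 0 the sum defining the logarithm is empty and has no linear term to split off.
  rcases Nat.eq_zero_or_pos (Module.finrank ℂ V) with h | h
  · have : Subsingleton V := Module.finrank_zero_iff.1 h
    rw [Subsingleton.elim (unipotentLog g - (g - 1)) 0]
    exact Submodule.zero_mem _
  · obtain ⟨m, hm⟩ := Nat.exists_eq_succ_of_ne_zero h.ne'
    rw [unipotentLog, hm, Finset.sum_range_succ']
    have : (∑ k ∈ Finset.range m, ((-1 : ℂ) ^ (k + 1) / (((k + 1 : ℕ) : ℂ) + 1)) •
        (g - 1) ^ (k + 1 + 1)) ∈ glBelow U (-2) := by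
      refine Submodule.sum_mem _ fun i _ => Submodule.smul_mem _ _ ?_
      exact glBelow_mono (by push_cast; omega) (pow_mem_glBelow hg (i + 1 + 1))
    convert this using 1
    simp

/-- The logarithm of a product of exponentials, to first order in the grading. -/
lemma unipotentLog_exp_mul_exp [Module ℚ (Module.End ℂ V)] [Module.Finite ℂ V] {α β : Module.End ℂ V}
    (hα : α ∈ glBelow U (-1)) (hβ : β ∈ glBelow U (-1)) (hα' : IsNilpotent α)
    (hβ' : IsNilpotent β) :
    unipotentLog (IsNilpotent.exp α * IsNilpotent.exp β) - (α + β) ∈ glBelow U (-2) := by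
  have ha := exp_sub_one_sub_mem_glBelow hα hα'
  have hb := exp_sub_one_sub_mem_glBelow hβ hβ'
  have h21 : glBelow U (-2) ≤ glBelow U (-1) := glBelow_mono (by norm_num)
  have ha1 : IsNilpotent.exp α - 1 ∈ glBelow U (-1) := by
    have := Submodule.add_mem _ (h21 ha) hα
    rwa [sub_add_cancel] at this
  have hb1 : IsNilpotent.exp β - 1 ∈ glBelow U (-1) := by
    have := Submodule.add_mem _ (h21 hb) hβ
    rwa [sub_add_cancel] at this
  have h2 : IsNilpotent.exp α * IsNilpotent.exp β - 1 - (α + β) ∈ glBelow U (-2) := by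
    have e : ∀ x y z w : Module.End ℂ V, x * y - 1 - (z + w) =
        (x - 1 - z) + (y - 1 - w) + (x - 1) * (y - 1) := by
      intro x y z w
      rw [mul_sub, sub_mul, mul_one, one_mul]
      abel
    have hab := mul_mem_glBelow ha1 hb1
    rw [show (-1 : ℤ) + -1 = -2 by norm_num] at hab
    rw [e]
    exact Submodule.add_mem _ (Submodule.add_mem _ ha hb) hab
  generalize IsNilpotent.exp α * IsNilpotent.exp β = y at h2 ⊢
  have h1 : y - 1 ∈ glBelow U (-1) :=
    (Submodule.sub_mem_iff_left _ (Submodule.add_mem _ hα hβ)).1 (h21 h2)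
  exact (sub_add_sub_cancel (unipotentLog y) (y - 1) (α + β)) ▸
    Submodule.add_mem _ (unipotentLog_sub_mem_glBelow h1) h2

lemma isComponent_of_sub_mem {a : ℤ} {α β : Module.End ℂ V} (hβ : β ∈ glGraded U a)
    (h : α - β ∈ ⨆ (b : ℤ) (_ : b ≠ a), glGraded U b) : IsComponent U a α β := by
  classical
  obtain ⟨f, hf, hsum⟩ := (Submodule.mem_iSup_iff_exists_finsupp _ _).1 h
  -- The summand of index a is a supremum over proofs of a ≠ a, hence ⊥.
  have hfa : f a = 0 := by
    have := hf a
    simpa using this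
  have hf' : ∀ b, f b ∈ glGraded U b := fun b => by
    by_cases hb : b = a
    · rw [hb, hfa]; exact Submodule.zero_mem _
    · have := hf b
      simpa [hb] using this
  refine ⟨f + Finsupp.single a β, fun b => ?_, ?_, by simp [hfa]⟩
  · rw [Finsupp.add_apply]
    refine Submodule.add_mem _ (hf' b) ?_
    by_cases hb : b = a
    · subst hb; simpa using hβ
    · rw [Finsupp.single_eq_of_ne hb]; exact Submodule.zero_mem _
  · rw [Finsupp.sum_add_index (by simp) (by simp), hsum]
    simp

/-- An x in both subspaces has x and 0 as components of degree a, so uniqueness of components gives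
x = 0. -/
lemma disjoint_glGraded (hU : DirectSum.IsInternal U) (a : ℤ) :
    Disjoint (glGraded U a) (⨆ (b : ℤ) (_ : b ≠ a), glGraded U b) := by
  rw [Submodule.disjoint_def]
  intro x hx hx'
  refine IsComponent.unique hU (isComponent_of_sub_mem (a := a) (α := x) hx ?_)
    (isComponent_of_sub_mem (Submodule.zero_mem _) ?_)
  · rw [sub_self]; exact Submodule.zero_mem _
  · rwa [sub_zero]

/-- The projection of `gl(V)` to its component of degree `a`. -/
lemma exists_component_map (hU : DirectSum.IsInternal U) (a : ℤ) :
    ∃ π : Module.End ℂ V →ₗ[ℂ] Module.End ℂ V, (∀ α ∈ glGraded U a, π α = α) ∧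
      ∀ b ≠ a, ∀ α ∈ glGraded U b, π α = 0 := by
  -- Any complement containing the other graded pieces will do: the projection is only controlled on
  -- their sum, which need not be shown to exhaust gl(V).
  obtain ⟨C, hC, hcompl⟩ := (disjoint_glGraded hU a).symm.exists_isCompl
  have hcompl := hcompl.symm
  refine ⟨(glGraded U a).subtype ∘ₗ Submodule.projectionOnto _ C hcompl,
    fun α hα => ?_, fun b hb α hα => ?_⟩
  · have := Submodule.projectionOnto_apply_left hcompl ⟨α, hα⟩
    simp only [LinearMap.comp_apply, Submodule.subtype_apply]
    exact congrArg Subtype.val this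
  · have hαC : α ∈ C := hC (le_iSup₂_of_le
      (f := fun b (_ : b ≠ a) => glGraded U b) b hb le_rfl hα)
    have := Submodule.projectionOnto_apply_right hcompl ⟨α, hαC⟩
    simpa using congrArg Subtype.val this

end GradedEnd

/-! ### Graded parts of a Lie algebra of endomorphisms -/

section LieGraded

variable {V : Type u} [AddCommGroup V] [Module ℂ V] {U : ℤ → Submodule ℂ V}
  {g : Submodule ℂ (Module.End ℂ V)}

/-- The sum of the graded parts of negative degree of `g ⊆ gl(V)`. -/
def negPart (g : Submodule ℂ (Module.End ℂ V)) (U : ℤ → Submodule ℂ V) :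
    Submodule ℂ (Module.End ℂ V) :=
  ⨆ (a : ℤ) (_ : a < 0), g ⊓ glGraded U a

lemma le_negPart {a : ℤ} (ha : a < 0) : g ⊓ glGraded U a ≤ negPart g U :=
  le_iSup₂_of_le (f := fun a (_ : a < 0) => g ⊓ glGraded U a) a ha le_rfl

lemma negPart_le {E : Submodule ℂ (Module.End ℂ V)} (h : ∀ a < 0, g ⊓ glGraded U a ≤ E) :
    negPart g U ≤ E := iSup₂_le h

lemma negPart_le_glBelow : negPart g U ≤ glBelow U (-1) :=
  negPart_le fun _ ha => inf_le_right.trans (glGraded_le_glBelow (by omega))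

lemma negPart_le_self : negPart g U ≤ g := negPart_le fun _ _ => inf_le_left

/-- Degrees add under the bracket, and a sum of negative degrees is negative. -/
lemma commutator_mem_negPart (hg : ∀ α ∈ g, ∀ β ∈ g, α * β - β * α ∈ g)
    {α β : Module.End ℂ V} (hα : α ∈ negPart g U) (hβ : β ∈ negPart g U) :
    α * β - β * α ∈ negPart g U := by
  have h1 : negPart g U ≤ (negPart g U).comap (LinearMap.mulRight ℂ β - LinearMap.mulLeft ℂ β) := by
    refine negPart_le fun a ha α hα => ?_
    have h2 : negPart g U ≤
        (negPart g U).comap (LinearMap.mulLeft ℂ α - LinearMap.mulRight ℂ α) := by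
      refine negPart_le fun b hb β hβ => le_negPart (a := a + b) (by omega) ⟨?_, ?_⟩
      · exact hg _ hα.1 _ hβ.1
      · refine Submodule.sub_mem _ (mul_mem_glGraded hα.2 hβ.2) ?_
        have := mul_mem_glGraded hβ.2 hα.2
        rwa [add_comm] at this
    exact h2 hβ
  exact h1 hα

/-- The summands are graded parts of g itself, so taking components does not leave g; every negative
degree other than -1 is at most -2. -/
lemma component_negPart {π : Module.End ℂ V →ₗ[ℂ] Module.End ℂ V}
    (hπ : ∀ α ∈ glGraded U (-1), π α = α) (hπ' : ∀ b ≠ -1, ∀ α ∈ glGraded U b, π α = 0)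
    {α : Module.End ℂ V} (hα : α ∈ negPart g U) :
    π α ∈ g ⊓ glGraded U (-1) ∧ α - π α ∈ glBelow U (-2) := by
  have h : negPart g U ≤ (g ⊓ glGraded U (-1)).comap π ⊓
      (glBelow U (-2)).comap (LinearMap.id - π) := by
    refine negPart_le fun a ha α hα => ?_
    by_cases h : a = -1
    · subst h
      have := hπ α hα.2
      refine ⟨?_, ?_⟩
      · simpa [this] using hα
      · simp [this]
    · have := hπ' a h α hα.2
      refine ⟨?_, ?_⟩
      · simp [this]
      · simpa [this] using glGraded_le_glBelow (c := -2) (by omega) hα.2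
  simpa using h hα

lemma isComponent_of_sub_mem_glBelow {α β : Module.End ℂ V} (hβ : β ∈ glGraded U (-1))
    (h : α - β ∈ glBelow U (-2)) : IsComponent U (-1) α β := by
  refine isComponent_of_sub_mem hβ ?_
  refine glBelow_le (fun a ha => ?_) h
  exact le_iSup₂_of_le (f := fun b (_ : b ≠ (-1 : ℤ)) => glGraded U b) a (by omega) le_rfl

/-- An element of negative degree which shifts the filtration `⨁_{r ≥ p} U^r` by at most `-1` is
of degree `-1`. -/
lemma mem_glGraded_of_mem_negPart (hU : DirectSum.IsInternal U) {α : Module.End ℂ V}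
    (hα : α ∈ negPart g U)
    (hF : ∀ p, ∀ x ∈ ⨆ (r : ℤ) (_ : p ≤ r), U r, α x ∈ ⨆ (r : ℤ) (_ : p - 1 ≤ r), U r) :
    α ∈ g ⊓ glGraded U (-1) := by
  obtain ⟨π, hπ, hπ'⟩ := exists_component_map hU (-1)
  obtain ⟨h1, h2⟩ := component_negPart hπ hπ' hα
  suffices α - π α = 0 by rwa [← sub_eq_zero.1 this] at h1
  -- The difference sends U^p into degrees ≤ p - 2, yet α and π α both stay in degrees ≥ p - 1.
  have hδ : ∀ p, ∀ x ∈ U p, (α - π α) x = 0 := by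
    intro p x hx
    have hlow : (α - π α) x ∈ ⨆ r ∈ {r | r ≤ p - 2}, U r := by
      have : glBelow U (-2) ≤ (⨆ r ∈ {r | r ≤ p - 2}, U r).comap (LinearMap.applyₗ x) := by
        refine glBelow_le fun a ha β hβ => ?_
        exact le_iSup₂_of_le (f := fun r (_ : r ∈ {r | r ≤ p - 2}) => U r) (p + a)
          (by simp only [Set.mem_ofPred_eq]; omega) le_rfl (hβ p x hx)
      exact this h2
    have hhigh : (α - π α) x ∈ ⨆ r ∈ {r | p - 1 ≤ r}, U r := by
      refine Submodule.sub_mem _ (hF p x ?_) ?_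
      · exact le_iSup₂_of_le (f := fun r (_ : p ≤ r) => U r) p le_rfl le_rfl hx
      · exact le_iSup₂_of_le (f := fun r (_ : r ∈ {r | p - 1 ≤ r}) => U r) (p + -1)
          (by simp only [Set.mem_ofPred_eq]; omega) le_rfl (h1.2 p x hx)
    rw [mem_biSup_iff_gradedProj hU] at hlow hhigh
    obtain ⟨s, hs⟩ := eq_sum_gradedProj hU ((α - π α) x)
    rw [hs]
    refine Finset.sum_eq_zero fun r _ => ?_
    by_cases hr : r ≤ p - 2
    · exact hhigh r (by simp only [Set.mem_ofPred_eq]; omega)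
    · exact hlow r hr
  have top : (⊤ : Submodule ℂ V) ≤ LinearMap.ker (α - π α) := by
    rw [← hU.submodule_iSup_eq_top]
    exact iSup_le hδ
  exact LinearMap.ext fun x => top (Submodule.mem_top : x ∈ ⊤)

end LieGraded

/-! ### The adjoint action -/

section Adjoint

variable {V : Type u} [AddCommGroup V] [Module ℂ V]

lemma exp_mulLeft [Module ℚ (Module.End ℂ V)] [Module ℚ (Module.End ℂ (Module.End ℂ V))]
    {x : Module.End ℂ V} (hx : IsNilpotent x) :
    IsNilpotent.exp (LinearMap.mulLeft ℂ x) = LinearMap.mulLeft ℂ (IsNilpotent.exp x) := by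
  obtain ⟨k, hk⟩ := hx
  have hk' : LinearMap.mulLeft ℂ x ^ k = 0 := by
    rw [LinearMap.pow_mulLeft, hk, LinearMap.mulLeft_zero_eq_zero]
  rw [exp_eq_sum_complex hk', exp_eq_sum_complex hk]
  ext y : 1
  simp [LinearMap.sum_apply, LinearMap.pow_mulLeft, Finset.sum_mul]

lemma exp_mulRight [Module ℚ (Module.End ℂ V)] [Module ℚ (Module.End ℂ (Module.End ℂ V))]
    {x : Module.End ℂ V} (hx : IsNilpotent x) :
    IsNilpotent.exp (LinearMap.mulRight ℂ x) = LinearMap.mulRight ℂ (IsNilpotent.exp x) := by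
  obtain ⟨k, hk⟩ := hx
  have hk' : LinearMap.mulRight ℂ x ^ k = 0 := by
    rw [LinearMap.pow_mulRight, hk, LinearMap.mulRight_zero_eq_zero]
  rw [exp_eq_sum_complex hk', exp_eq_sum_complex hk]
  ext y : 1
  simp [LinearMap.sum_apply, LinearMap.pow_mulRight, Finset.mul_sum]

lemma isNilpotent_mulLeft {x : Module.End ℂ V} (hx : IsNilpotent x) :
    IsNilpotent (LinearMap.mulLeft ℂ x) := by
  obtain ⟨k, hk⟩ := hx
  exact ⟨k, by rw [LinearMap.pow_mulLeft, hk, LinearMap.mulLeft_zero_eq_zero]⟩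

lemma isNilpotent_mulRight {x : Module.End ℂ V} (hx : IsNilpotent x) :
    IsNilpotent (LinearMap.mulRight ℂ x) := by
  obtain ⟨k, hk⟩ := hx
  exact ⟨k, by rw [LinearMap.pow_mulRight, hk, LinearMap.mulRight_zero_eq_zero]⟩

/-- The two multiplication operators commute, so this splitting makes e^{-ad x} the product of their
exponentials, that is, conjugation. -/
lemma neg_adEnd_eq (x : Module.End ℂ V) :
    -adEnd x = LinearMap.mulLeft ℂ (-x) + LinearMap.mulRight ℂ x := by
  ext y : 1
  simp [adEnd]
  abel

lemma commute_mulLeft_mulRight (x y : Module.End ℂ V) :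
    Commute (LinearMap.mulLeft ℂ x) (LinearMap.mulRight ℂ y) := by
  ext z : 1
  simp [mul_assoc]

lemma isNilpotent_neg_adEnd {x : Module.End ℂ V} (hx : IsNilpotent x) :
    IsNilpotent (-adEnd x) := by
  rw [neg_adEnd_eq]
  exact (commute_mulLeft_mulRight _ _).isNilpotent_add (isNilpotent_mulLeft hx.neg)
    (isNilpotent_mulRight hx)

/-- `e^{-ad x} y = e^{-x} y e^x`. -/
lemma exp_neg_adEnd_apply [Module ℚ (Module.End ℂ V)] [Module ℚ (Module.End ℂ (Module.End ℂ V))]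
    {x : Module.End ℂ V} (hx : IsNilpotent x) (y : Module.End ℂ V) :
    IsNilpotent.exp (-adEnd x) y = IsNilpotent.exp (-x) * y * IsNilpotent.exp x := by
  rw [neg_adEnd_eq, IsNilpotent.exp_add_of_commute (commute_mulLeft_mulRight _ _)
    (isNilpotent_mulLeft hx.neg) (isNilpotent_mulRight hx), exp_mulLeft hx.neg, exp_mulRight hx]
  simp [mul_assoc]

/-- A subspace stable under `ad x` is stable under `e^{-ad x}`. -/
lemma exp_neg_adEnd_mem [Module ℚ (Module.End ℂ (Module.End ℂ V))] {M : Submodule ℂ (Module.End ℂ V)} {x y : Module.End ℂ V}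
    (hx : IsNilpotent x) (hM : ∀ z ∈ M, x * z - z * x ∈ M) (hy : y ∈ M) :
    IsNilpotent.exp (-adEnd x) y ∈ M := by
  obtain ⟨k, hk⟩ := isNilpotent_neg_adEnd hx
  rw [exp_eq_sum_complex hk, LinearMap.sum_apply]
  refine Submodule.sum_mem _ fun i hi => ?_
  clear hi
  rw [LinearMap.smul_apply]
  refine Submodule.smul_mem _ _ ?_
  induction i with
  | zero => simpa using hy
  | succ i ih =>
    rw [pow_succ', Module.End.mul_apply, LinearMap.neg_apply]
    exact Submodule.neg_mem _ (hM _ ih)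

end Adjoint

/-! ### Closure of Lie(G_ℂ) under commutators. -/

section LieG

variable {H : Type u} [AddCommGroup H] [Module ℚ H]

lemma commutator_mem_lieG {W : ℤ → Submodule ℚ H} {S : ∀ k, LinearMap.BilinForm ℚ (Gr W k)}
    {α β : Module.End ℂ (ℂ ⊗[ℚ] H)} (hα : α ∈ lieG W S) (hβ : β ∈ lieG W S) :
    α * β - β * α ∈ lieG W S := by
  intro k
  obtain ⟨a, b, h1, h2, h3⟩ := hα k
  obtain ⟨a', b', h1', h2', h3'⟩ := hβ k
  refine ⟨a * a' - a' * a, b * b' - b' * b, fun x => ?_, fun x => ?_, fun u v => ?_⟩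
  · simp only [LinearMap.sub_apply, Module.End.mul_apply, map_sub, h1, h1']
  · simp only [LinearMap.sub_apply, Module.End.mul_apply, map_sub, h2, h2']
  · have e1 := h3 (b' u) v
    have e2 := h3' (b u) v
    have e3 := h3 u (b' v)
    have e4 := h3' u (b v)
    simp only [LinearMap.sub_apply, Module.End.mul_apply, map_sub]
    linear_combination e1 - e2 + e3 - e4

end LieG

/-! ### The grading by the first index of the Deligne bigrading. -/

section DeligneGrading

variable {H : Type u} [AddCommGroup H] [Module ℚ H] {F : ℤ → Submodule ℂ (ℂ ⊗[ℚ] H)}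
  {W : ℤ → Submodule ℚ H} {I : ℤ → ℤ → Submodule ℂ (ℂ ⊗[ℚ] H)}

lemma IsDeligneBigrading.isInternal_iSup (hI : IsDeligneBigrading F W I) :
    DirectSum.IsInternal fun p => ⨆ q, I p q := by
  rw [DirectSum.isInternal_submodule_iff_iSupIndep_and_iSup_eq_top]
  constructor
  · intro p
    rw [Submodule.disjoint_def]
    intro x h1 h2
    have h1' : x ∈ part I {i | i.1 = p} :=
      (iSup_le fun q => le_part rfl : (⨆ q, I p q) ≤ _) h1
    have h2' : x ∈ part I {i | i.1 ≠ p} :=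
      (iSup₂_le fun r hr => iSup_le fun q => le_part hr :
        (⨆ (r : ℤ) (_ : r ≠ p), ⨆ q, I r q) ≤ _) h2
    rw [hI.mem_part] at h1' h2'
    obtain ⟨s, hs⟩ := eq_sum_gradedProj hI.internal x
    rw [hs]
    refine Finset.sum_eq_zero fun i _ => ?_
    by_cases hi : i.1 = p
    · exact h2' i (by simpa using hi)
    · exact h1' i hi
  · rw [← top_le_iff, ← hI.internal.submodule_iSup_eq_top]
    exact iSup_le fun i => le_iSup_of_le i.1 (le_iSup (fun q => I i.1 q) i.2)

lemma IsDeligneBigrading.mem_glGraded (hI : IsDeligneBigrading F W I) {f : Module.End ℚ H}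
    (hF : ∀ p, (F p).map (f.baseChange ℂ) ≤ F (p - 1))
    (hW : ∀ k, (W k).map f ≤ W (k - 2)) :
    f.baseChange ℂ ∈ glGraded (fun p => ⨆ q, I p q) (-1) := by
  intro p x hx
  have : (⨆ q, I p q) ≤ (⨆ q, I (p + -1) q).comap (f.baseChange ℂ) :=
    iSup_le fun q y hy => Submodule.mem_iSup_of_mem (q - 1) (hI.map_mem hF hW hy)
  exact this hx

end DeligneGrading

/-! ### Derivatives of holomorphic functions of several variables -/

section SeveralVariables

open MeasureTheory Metric

variable {n : ℕ}

/-- Reduces measurability and differentiability of the operator valued map `fderiv ℂ f` to its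
values on basis vectors. -/
lemma clm_eq_sum_proj (L : (Fin n → ℂ) →L[ℂ] ℂ) :
    L = ∑ j, L (Pi.single j 1) • (ContinuousLinearMap.proj j : (Fin n → ℂ) →L[ℂ] ℂ) := by
  ext x
  conv_lhs => rw [pi_eq_sum_univ' x, map_sum]
  simp [mul_comm]

lemma stronglyMeasurable_fderiv_fin (f : (Fin n → ℂ) → ℂ) :
    StronglyMeasurable fun s => fderiv ℂ f s := by
  have : (fun s => fderiv ℂ f s) = fun s => ∑ j, fderiv ℂ f s (Pi.single j 1) •
      (ContinuousLinearMap.proj j : (Fin n → ℂ) →L[ℂ] ℂ) := funext fun s => clm_eq_sum_proj _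
  rw [this]
  refine Finset.stronglyMeasurable_fun_sum _ fun j _ => ?_
  exact (measurable_fderiv_apply_const ℂ f _).stronglyMeasurable.smul_const _

/-- Directional derivatives of holomorphic functions of several variables are holomorphic. -/
lemma differentiableOn_fderiv_apply {f : (Fin n → ℂ) → ℂ} {O : Set (Fin n → ℂ)} (hO : IsOpen O)
    (hf : DifferentiableOn ℂ f O) (v : Fin n → ℂ) :
    DifferentiableOn ℂ (fun s => fderiv ℂ f s v) O := by
  intro x₀ hx₀
  refine DifferentiableAt.differentiableWithinAt ?_
  obtain ⟨ε, hε, hεO⟩ := Metric.isOpen_iff.1 hO x₀ hx₀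
  obtain ⟨R, hR, h4R⟩ : ∃ R > 0, closedBall x₀ (4 * R) ⊆ O :=
    ⟨ε / 8, by positivity, (closedBall_subset_ball (by linarith)).trans hεO⟩
  obtain ⟨M, hM⟩ := (isCompact_closedBall x₀ (4 * R)).exists_bound_of_continuousOn
    (hf.continuousOn.mono h4R)
  -- For |t| < 2δ and s within R of x₀, the point s + tv stays within 3R of x₀; this leaves room R
  -- for a Cauchy estimate inside the ball of radius 4R where |f| ≤ M.
  set δ := R / (‖v‖ + 1) with hδ
  have hδ0 : 0 < δ := by positivity
  have hδv : δ * ‖v‖ ≤ R := by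
    rw [hδ, div_mul_eq_mul_div, div_le_iff₀ (by positivity)]
    nlinarith [norm_nonneg v]
  have hdiff : ∀ y ∈ closedBall x₀ (4 * R), DifferentiableAt ℂ f y := fun y hy =>
    hf.differentiableAt (hO.mem_nhds (h4R hy))
  have hmem : ∀ s ∈ ball x₀ R, ∀ t : ℂ, ‖t‖ < 2 * δ → s + t • v ∈ ball x₀ (3 * R) := by
    intro s hs t ht
    rw [mem_ball, dist_eq_norm] at hs ⊢
    have h1 : ‖t • v‖ ≤ 2 * R := by
      rw [norm_smul]
      nlinarith [norm_nonneg v, mul_le_mul_of_nonneg_right ht.le (norm_nonneg v)]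
    calc ‖s + t • v - x₀‖ = ‖(s - x₀) + t • v‖ := by congr 1; abel
      _ ≤ ‖s - x₀‖ + ‖t • v‖ := norm_add_le _ _
      _ < 3 * R := by linarith
  have h34 : ball x₀ (3 * R) ⊆ closedBall x₀ (4 * R) :=
    ball_subset_closedBall.trans (closedBall_subset_closedBall (by linarith))
  have hcircle : ∀ θ, ‖circleMap 0 δ θ‖ < 2 * δ := fun θ => by
    rw [norm_circleMap_zero, abs_of_pos hδ0]; linarith
  set k : ℝ → ℂ := fun θ => deriv (circleMap 0 δ) θ * ((circleMap 0 δ θ - 0) ^ 2)⁻¹ with hk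
  have hkc : Continuous k := by
    rw [hk]
    simp only [deriv_circleMap, sub_zero]
    refine Continuous.mul (by fun_prop) (Continuous.inv₀ (by fun_prop) fun θ => ?_)
    exact pow_ne_zero _ (circleMap_ne_center hδ0.ne')
  have hkn : ∀ θ, ‖k θ‖ ≤ δ⁻¹ := fun θ => by
    rw [hk]
    simp only [deriv_circleMap, sub_zero, norm_mul, norm_inv, norm_pow, norm_circleMap_zero,
      abs_of_pos hδ0, Complex.norm_I]
    apply le_of_eq
    field_simp
  -- Cauchy's formula
  have hcauchy : ∀ s ∈ ball x₀ R, fderiv ℂ f s v = (2 * Real.pi * Complex.I)⁻¹ *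
      ∫ θ in Set.Ioc 0 (2 * Real.pi), k θ * f (s + circleMap 0 δ θ • v) := by
    intro s hs
    have hg : ∀ t ∈ ball (0 : ℂ) (2 * δ), HasDerivAt (fun t : ℂ => f (s + t • v))
        (fderiv ℂ f (s + t • v) v) t := by
      intro t ht
      have h1 : HasDerivAt (fun t : ℂ => s + t • v) v t := by
        simpa using ((hasDerivAt_id t).smul_const v).const_add s
      exact (hdiff _ (h34 (hmem s hs t (by simpa using ht)))).hasFDerivAt.comp_hasDerivAt t h1
    have h0 := Complex.two_pi_I_inv_smul_circleIntegral_sub_sq_inv_smul_of_differentiable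
      (isOpen_ball (x := (0 : ℂ)) (ε := 2 * δ)) (closedBall_subset_ball (by linarith : δ < 2 * δ))
      (fun t ht => (hg t ht).differentiableAt.differentiableWithinAt) (mem_ball_self hδ0)
    rw [(hg 0 (by simpa using hδ0)).deriv] at h0
    simp only [zero_smul, add_zero] at h0
    rw [← h0, circleIntegral, intervalIntegral.integral_of_le Real.two_pi_pos.le, smul_eq_mul]
    simp only [hk, smul_eq_mul, mul_assoc]
  have hcont : ∀ x ∈ ball x₀ R, Continuous fun θ => k θ * f (x + circleMap 0 δ θ • v) := by
    intro x hx
    refine hkc.mul (continuous_iff_continuousAt.2 fun θ => ?_)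
    have h1 : ContinuousAt f (x + circleMap 0 δ θ • v) :=
      (hdiff _ (h34 (hmem x hx _ (hcircle θ)))).continuousAt
    exact ContinuousAt.comp (f := fun θ => x + circleMap 0 δ θ • v) h1 (by fun_prop)
  -- Differentiation under the integral: the kernel is bounded by 1/δ and, by the Cauchy estimate,
  -- the derivative of f by 2M/R.
  have hint : HasFDerivAt
      (fun s => ∫ θ in Set.Ioc 0 (2 * Real.pi), k θ * f (s + circleMap 0 δ θ • v))
      (∫ θ in Set.Ioc 0 (2 * Real.pi), k θ • fderiv ℂ f (x₀ + circleMap 0 δ θ • v)) x₀ := by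
    refine hasFDerivAt_integral_of_dominated_of_fderiv_le (bound := fun _ => δ⁻¹ * (2 * M / R))
      (F' := fun s θ => k θ • fderiv ℂ f (s + circleMap 0 δ θ • v))
      (ball_mem_nhds x₀ hR) ?_ ?_ ?_ ?_ ?_ ?_
    · filter_upwards [ball_mem_nhds x₀ hR] with x hx
      exact (hcont x hx).aestronglyMeasurable
    · exact ((hcont x₀ (mem_ball_self hR)).continuousOn.integrableOn_Icc).mono_set
        Set.Ioc_subset_Icc_self
    · refine StronglyMeasurable.aestronglyMeasurable ?_
      refine hkc.stronglyMeasurable.smul ?_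
      exact (stronglyMeasurable_fderiv_fin f).comp_measurable
        (by fun_prop : Continuous fun θ => x₀ + circleMap 0 δ θ • v).measurable
    · refine Filter.Eventually.of_forall fun θ x hx => ?_
      have hy := hmem x hx _ (hcircle θ)
      set y := x + circleMap 0 δ θ • v
      have hyR : ball y R ⊆ closedBall x₀ (4 * R) := by
        refine (ball_subset_ball' ?_).trans ball_subset_closedBall
        rw [mem_ball] at hy
        linarith
      have hb : ‖fderiv ℂ f y‖ ≤ 2 * M / R := by
        refine Complex.norm_fderiv_le_div_of_mapsTo_ball
          (fun z hz => (hdiff z (hyR hz)).differentiableWithinAt) (fun z hz => ?_) hR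
        rw [mem_closedBall, dist_eq_norm]
        have h1 := hM z (hyR hz)
        have h2 := hM y (h34 hy)
        linarith [norm_sub_le (f z) (f y)]
      rw [norm_smul]
      exact mul_le_mul (hkn θ) hb (norm_nonneg _) (by positivity)
    · exact integrable_const _
    · refine Filter.Eventually.of_forall fun θ x hx => ?_
      have h1 : HasFDerivAt (fun s => s + circleMap 0 δ θ • v)
          (ContinuousLinearMap.id ℂ (Fin n → ℂ)) x := (hasFDerivAt_id x).add_const _
      have h2 := (hdiff _ (h34 (hmem x hx _ (hcircle θ)))).hasFDerivAt.comp x h1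
      simpa using h2.const_mul (k θ)
  have hfin := (hint.const_mul (2 * Real.pi * Complex.I)⁻¹).differentiableAt
  refine hfin.congr_of_eventuallyEq ?_
  filter_upwards [ball_mem_nhds x₀ hR] with s hs using hcauchy s hs

/-- Symmetry of the second derivatives of a holomorphic function of several variables. -/
lemma fderiv_fderiv_apply_comm {f : (Fin n → ℂ) → ℂ} {O : Set (Fin n → ℂ)} (hO : IsOpen O)
    (hf : DifferentiableOn ℂ f O) {x : Fin n → ℂ} (hx : x ∈ O) (v w : Fin n → ℂ) :
    fderiv ℂ (fun s => fderiv ℂ f s v) x w = fderiv ℂ (fun s => fderiv ℂ f s w) x v := by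
  -- The derivative is a finite combination of directional derivatives, each holomorphic, so the
  -- general symmetry theorem applies.
  have hd : DifferentiableAt ℂ (fderiv ℂ f) x := by
    have : fderiv ℂ f = fun s => ∑ j, fderiv ℂ f s (Pi.single j 1) •
        (ContinuousLinearMap.proj j : (Fin n → ℂ) →L[ℂ] ℂ) := funext fun s => clm_eq_sum_proj _
    rw [this]
    refine DifferentiableAt.fun_sum fun j _ => ?_
    exact ((differentiableOn_fderiv_apply hO hf _).differentiableAt
      (hO.mem_nhds hx)).smul_const _
  have hs := second_derivative_symmetric_of_eventually (f := f) (f' := fderiv ℂ f)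
    (f'' := fderiv ℂ (fderiv ℂ f) x) (x := x)
    (by filter_upwards [hO.mem_nhds hx] with y hy using
      (hf.differentiableAt (hO.mem_nhds hy)).hasFDerivAt) hd.hasFDerivAt w v
  rw [fderiv_clm_apply hd (differentiableAt_const v), fderiv_clm_apply hd (differentiableAt_const w)]
  simpa using hs

end SeveralVariables

/-! ### Calculus of holomorphic maps into finite dimensional vector spaces -/

section Calculus

variable {n : ℕ} {V : Type*} [AddCommGroup V] [Module ℂ V]
  {W : Type*} [AddCommGroup W] [Module ℂ W] {X : Type*} [AddCommGroup X] [Module ℂ X]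
  {O : Set (Fin n → ℂ)} {j : Fin n} {s : Fin n → ℂ}

lemma eventually_update_mem (hO : IsOpen O) (hs : s ∈ O) (j : Fin n) :
    ∀ᶠ t in nhds (s j), Function.update s j t ∈ O := by
  have hc : Continuous fun t : ℂ => Function.update s j t := continuous_const.update j continuous_id
  refine hc.continuousAt.preimage_mem_nhds (hO.mem_nhds ?_)
  simpa using hs

/-- Holomorphy and partial derivatives are tested on linear functionals; this expansion reduces
product rules to products of scalar coordinates. -/
lemma dual_bilin_eq_sum {ι κ : Type*} [Fintype ι] [Fintype κ] (b : Module.Basis ι ℂ V)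
    (c : Module.Basis κ ℂ W) (B : V →ₗ[ℂ] W →ₗ[ℂ] X) (l : Module.Dual ℂ X) (x : V) (y : W) :
    l (B x y) = ∑ i, ∑ k, b.coord i x * c.coord k y * l (B (b i) (c k)) := by
  conv_lhs => rw [← b.sum_repr x, ← c.sum_repr y]
  simp only [map_sum, map_smul, LinearMap.sum_apply, LinearMap.smul_apply, smul_eq_mul,
    Finset.mul_sum, Module.Basis.coord_apply]
  rw [Finset.sum_comm]
  exact Finset.sum_congr rfl fun i _ => Finset.sum_congr rfl fun k _ => by ring

namespace HasPartial

lemma unique {f : (Fin n → ℂ) → V} {w w' : V} (h : HasPartial j f s w)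
    (h' : HasPartial j f s w') : w = w' := by
  rw [← sub_eq_zero, ← Module.forall_dual_apply_eq_zero_iff ℂ]
  intro l
  rw [map_sub, (h l).unique (h' l), sub_self]

lemma congr_of_eqOn {f g : (Fin n → ℂ) → V} {w : V} (h : HasPartial j f s w) (hO : IsOpen O)
    (hs : s ∈ O) (hfg : Set.EqOn g f O) : HasPartial j g s w := fun l =>
  (h l).congr_of_eventuallyEq
    ((eventually_update_mem hO hs j).mono fun t ht => by simp only [hfg ht])

lemma linear {f : (Fin n → ℂ) → V} {w : V} (h : HasPartial j f s w) (L : V →ₗ[ℂ] W) :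
    HasPartial j (fun z => L (f z)) s (L w) := fun l => h (l ∘ₗ L)

lemma const (c : V) : HasPartial j (fun _ => c) s 0 := fun l => by
  simpa using hasDerivAt_const (s j) (l c)

lemma add {f g : (Fin n → ℂ) → V} {w w' : V} (h : HasPartial j f s w)
    (h' : HasPartial j g s w') : HasPartial j (fun z => f z + g z) s (w + w') := fun l => by
  simp only [map_add]
  exact (h l).add (h' l)

lemma sum {ι : Type*} {S : Finset ι} {f : ι → (Fin n → ℂ) → V} {w : ι → V}
    (h : ∀ i ∈ S, HasPartial j (f i) s (w i)) :
    HasPartial j (fun z => ∑ i ∈ S, f i z) s (∑ i ∈ S, w i) := fun l => by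
  simp only [map_sum]
  exact HasDerivAt.fun_sum fun i hi => h i hi l

lemma const_smul {f : (Fin n → ℂ) → V} {w : V} (h : HasPartial j f s w) (c : ℂ) :
    HasPartial j (fun z => c • f z) s (c • w) := h.linear (c • LinearMap.id)

lemma bilin [Module.Finite ℂ V] [Module.Finite ℂ W] (B : V →ₗ[ℂ] W →ₗ[ℂ] X)
    {f : (Fin n → ℂ) → V} {g : (Fin n → ℂ) → W} {v : V} {w : W}
    (hf : HasPartial j f s v) (hg : HasPartial j g s w) :
    HasPartial j (fun z => B (f z) (g z)) s (B v (g s) + B (f s) w) := by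
  intro l
  set b := Module.finBasis ℂ V
  set c := Module.finBasis ℂ W
  have key := dual_bilin_eq_sum b c B l
  have key' : (fun t => l (B (f (Function.update s j t)) (g (Function.update s j t)))) = fun t =>
      ∑ i, ∑ k, b.coord i (f (Function.update s j t)) * c.coord k (g (Function.update s j t)) *
        l (B (b i) (c k)) := funext fun t => key _ _
  rw [key', map_add, key, key]
  have hd := HasDerivAt.fun_sum (u := Finset.univ) fun i _ =>
    HasDerivAt.fun_sum (u := Finset.univ) fun k _ =>
      ((hf (b.coord i)).mul (hg (c.coord k))).mul_const (l (B (b i) (c k)))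
  refine hd.congr_deriv ?_
  simp only [Function.update_eq_self]
  rw [← Finset.sum_add_distrib]
  refine Finset.sum_congr rfl fun i _ => ?_
  rw [← Finset.sum_add_distrib]
  exact Finset.sum_congr rfl fun k _ => by ring

lemma mul {A : Type*} [Ring A] [Algebra ℂ A] [Module.Finite ℂ A] {f g : (Fin n → ℂ) → A}
    {v w : A} (hf : HasPartial j f s v) (hg : HasPartial j g s w) :
    HasPartial j (fun z => f z * g z) s (v * g s + f s * w) :=
  bilin (LinearMap.mul ℂ A) hf hg

/-- Derivatives of a map with values in a subspace belong to the subspace. -/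
lemma mem_of_forall_mem {f : (Fin n → ℂ) → V} {w : V} {M : Submodule ℂ V}
    (h : HasPartial j f s w) (hO : IsOpen O) (hs : s ∈ O) (hf : ∀ z ∈ O, f z ∈ M) : w ∈ M := by
  by_contra hw
  obtain ⟨l, hl, hlM⟩ := Submodule.exists_le_ker_of_notMem hw
  refine hl ((h l).unique ((hasDerivAt_const (s j) (0 : ℂ)).congr_of_eventuallyEq ?_))
  exact (eventually_update_mem hO hs j).mono fun t ht => hlM (hf _ ht)

/-- Only s_j depends on z_j, so ∂/∂z_j = 2πi s_j ∂/∂s_j. -/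
lemma comp_expMap {f : (Fin n → ℂ) → V} {w : V} {z : Fin n → ℂ}
    (h : HasPartial j f (expMap z) w) :
    HasPartial j (fun z => f (expMap z)) z ((2 * Real.pi * Complex.I * expMap z j) • w) := by
  intro l
  have he : ∀ t, expMap (Function.update z j t) =
      Function.update (expMap z) j (Complex.exp (2 * Real.pi * Complex.I * t)) := by
    intro t
    ext i
    by_cases hi : i = j
    · subst hi; simp [expMap]
    · simp [expMap, hi]
  simp only [he]
  have h1 : HasDerivAt (fun t : ℂ => Complex.exp (2 * Real.pi * Complex.I * t))
      (2 * Real.pi * Complex.I * expMap z j) (z j) := by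
    have := ((hasDerivAt_id (z j)).const_mul (2 * Real.pi * Complex.I)).cexp
    simpa [expMap, mul_comm, mul_left_comm] using this
  have h2 : HasDerivAt (fun t => l (f (Function.update (expMap z) j t))) (l w)
      (Complex.exp (2 * Real.pi * Complex.I * z j)) := h l
  have h3 := HasDerivAt.comp (z j) h2 h1
  refine h3.congr_deriv ?_
  rw [map_smul, smul_eq_mul, mul_comm]

end HasPartial

lemma hasPartial_coord (j : Fin n) (z : Fin n → ℂ) (c : Fin n → V) :
    HasPartial j (fun z => ∑ i, z i • c i) z (c j) := by
  have : HasPartial j (fun z : Fin n → ℂ => ∑ i, z i • c i) z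
      (∑ i, (if i = j then (1 : ℂ) else 0) • c i) := by
    refine HasPartial.sum fun i _ l => ?_
    simp only [map_smul, smul_eq_mul]
    refine HasDerivAt.mul_const ?_ _
    by_cases hi : i = j
    · subst hi
      simpa using hasDerivAt_id' (z i)
    · simpa [hi] using hasDerivAt_const (z j) (z i)
  simpa using this

namespace IsHol

lemma mono {O' : Set (Fin n → ℂ)} {f : (Fin n → ℂ) → V} (h : IsHol O f) (hO : O' ⊆ O) :
    IsHol O' f := fun l => (h l).mono hO

lemma congr {f g : (Fin n → ℂ) → V} (h : IsHol O f) (hfg : Set.EqOn g f O) : IsHol O g :=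
  fun l => (h l).congr fun z hz => by simp only [hfg hz]

lemma linear {f : (Fin n → ℂ) → V} (h : IsHol O f) (L : V →ₗ[ℂ] W) :
    IsHol O (fun z => L (f z)) := fun l => h (l ∘ₗ L)

lemma const (c : V) : IsHol O (fun _ => c) := fun l => differentiableOn_const (l c)

lemma add {f g : (Fin n → ℂ) → V} (h : IsHol O f) (h' : IsHol O g) :
    IsHol O (fun z => f z + g z) := fun l => by
  simp only [map_add]
  exact (h l).add (h' l)

lemma sum {ι : Type*} {S : Finset ι} {f : ι → (Fin n → ℂ) → V} (h : ∀ i ∈ S, IsHol O (f i)) :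
    IsHol O (fun z => ∑ i ∈ S, f i z) := fun l => by
  simp only [map_sum]
  exact DifferentiableOn.fun_sum fun i hi => h i hi l

lemma const_smul {f : (Fin n → ℂ) → V} (h : IsHol O f) (c : ℂ) :
    IsHol O (fun z => c • f z) := h.linear (c • LinearMap.id)

lemma smul_const {c : (Fin n → ℂ) → ℂ} (h : DifferentiableOn ℂ c O) (v : V) :
    IsHol O (fun z => c z • v) := fun l => by
  simp only [map_smul, smul_eq_mul]
  exact h.mul_const _

lemma bilin [Module.Finite ℂ V] [Module.Finite ℂ W] (B : V →ₗ[ℂ] W →ₗ[ℂ] X)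
    {f : (Fin n → ℂ) → V} {g : (Fin n → ℂ) → W} (hf : IsHol O f) (hg : IsHol O g) :
    IsHol O (fun z => B (f z) (g z)) := by
  intro l
  set b := Module.finBasis ℂ V
  set c := Module.finBasis ℂ W
  have key : (fun z => l (B (f z) (g z))) = fun z =>
      ∑ i, ∑ k, b.coord i (f z) * c.coord k (g z) * l (B (b i) (c k)) :=
    funext fun z => dual_bilin_eq_sum b c B l _ _
  rw [key]
  exact DifferentiableOn.fun_sum fun i _ => DifferentiableOn.fun_sum fun k _ =>
    ((hf (b.coord i)).mul (hg (c.coord k))).mul_const _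

lemma mul {A : Type*} [Ring A] [Algebra ℂ A] [Module.Finite ℂ A] {f g : (Fin n → ℂ) → A}
    (hf : IsHol O f) (hg : IsHol O g) : IsHol O (fun z => f z * g z) :=
  bilin (LinearMap.mul ℂ A) hf hg

lemma pow {A : Type*} [Ring A] [Algebra ℂ A] [Module.Finite ℂ A] {f : (Fin n → ℂ) → A}
    (hf : IsHol O f) (k : ℕ) : IsHol O (fun z => f z ^ k) := by
  induction k with
  | zero => simpa using const (1 : A)
  | succ k ih => simpa only [pow_succ] using ih.mul hf

lemma comp_expMap {f : (Fin n → ℂ) → V} (h : IsHol O f) :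
    IsHol (expMap ⁻¹' O) (fun z => f (expMap z)) := fun l =>
  (h l).comp (by
    unfold expMap
    fun_prop : Differentiable ℂ (expMap : (Fin n → ℂ) → _)).differentiableOn fun _ hz => hz

end IsHol

/-- The partial derivatives of a holomorphic map. -/
noncomputable def partialDeriv [Module.Finite ℂ V] (j : Fin n) (f : (Fin n → ℂ) → V)
    (s : Fin n → ℂ) : V :=
  ∑ i, fderiv ℂ (fun z => (Module.finBasis ℂ V).coord i (f z)) s (Pi.single j 1) •
    Module.finBasis ℂ V i

lemma dual_partialDeriv [Module.Finite ℂ V] {f : (Fin n → ℂ) → V} (hf : IsHol O f)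
    (hO : IsOpen O) (hs : s ∈ O) (l : Module.Dual ℂ V) :
    l (partialDeriv j f s) = fderiv ℂ (fun z => l (f z)) s (Pi.single j 1) := by
  set b := Module.finBasis ℂ V with hb
  have h1 : (fun z => l (f z)) = fun z => ∑ i, b.coord i (f z) * l (b i) := by
    funext z
    conv_lhs => rw [← b.sum_repr (f z), map_sum]
    simp only [map_smul, smul_eq_mul, Module.Basis.coord_apply]
  rw [h1, partialDeriv, map_sum]
  have hd : ∀ i, HasFDerivAt (fun z => b.coord i (f z) * l (b i))
      (l (b i) • fderiv ℂ (fun z => b.coord i (f z)) s) s := fun i =>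
    (((hf (b.coord i)).differentiableAt (hO.mem_nhds hs)).hasFDerivAt).mul_const _
  rw [(HasFDerivAt.fun_sum fun i (_ : i ∈ Finset.univ) => hd i).fderiv]
  simp [hb, mul_comm]

lemma IsHol.hasPartial [Module.Finite ℂ V] {f : (Fin n → ℂ) → V} (hf : IsHol O f)
    (hO : IsOpen O) (hs : s ∈ O) (j : Fin n) : HasPartial j f s (partialDeriv j f s) := by
  intro l
  rw [dual_partialDeriv hf hO hs]
  have h1 : HasFDerivAt (fun z => l (f z)) (fderiv ℂ (fun z => l (f z)) s)
      (Function.update s j (s j)) := by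
    rw [Function.update_eq_self]
    exact ((hf l).differentiableAt (hO.mem_nhds hs)).hasFDerivAt
  exact h1.comp_hasDerivAt (s j) (hasDerivAt_update s j (s j))

lemma IsHol.partialDeriv [Module.Finite ℂ V] {f : (Fin n → ℂ) → V} (hf : IsHol O f)
    (hO : IsOpen O) (j : Fin n) : IsHol O (partialDeriv j f) := fun l =>
  (differentiableOn_fderiv_apply hO (hf l) (Pi.single j 1)).congr fun _ hz =>
    dual_partialDeriv hf hO hz l

lemma partialDeriv_comm [Module.Finite ℂ V] {f : (Fin n → ℂ) → V} (hf : IsHol O f)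
    (hO : IsOpen O) (hs : s ∈ O) (i j : Fin n) :
    partialDeriv i (partialDeriv j f) s = partialDeriv j (partialDeriv i f) s := by
  rw [← sub_eq_zero, ← Module.forall_dual_apply_eq_zero_iff ℂ]
  intro l
  have key : ∀ i j : Fin n, l (partialDeriv i (partialDeriv j f) s) =
      fderiv ℂ (fun z => fderiv ℂ (fun z => l (f z)) z (Pi.single j 1)) s (Pi.single i 1) := by
    intro i j
    rw [dual_partialDeriv (hf.partialDeriv hO j) hO hs]
    congr 1
    refine Filter.EventuallyEq.fderiv_eq ?_
    filter_upwards [hO.mem_nhds hs] with z hz using dual_partialDeriv hf hO hz l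
  rw [map_sub, key, key, fderiv_fderiv_apply_comm hO (hf l) hs, sub_self]

end Calculus

/-! ### The logarithmic derivative of the exponential -/

section ExpDerivative

variable {A : Type*} [Ring A]

/-- The derivative of `x ↦ x ^ i` at `x` in the direction `y`. -/
def powDeriv (x y : A) : ℕ → A
  | 0 => 0
  | i + 1 => y * x ^ i + x * powDeriv x y i

/-- Pascal's rule pairs (-x)^a D(x^{i+1}) with (-x)^{a+1} D(x^i), where D denotes `powDeriv x y`. By
D(x^{i+1}) = y x^i + x D(x^i), the pair collapses to (-x)^a y x^i, a term of the binomial expansion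
of (L_{-x} + R_x)^m. -/
lemma sum_choose_powDeriv [Algebra ℂ A] (x y : A) (m : ℕ) :
    ∑ p ∈ Finset.HasAntidiagonal.antidiagonal (m + 1), (m + 1).choose p.1 • ((-x) ^ p.1 * powDeriv x y p.2) =
      ((LinearMap.mulRight ℂ x - LinearMap.mulLeft ℂ x) ^ m) y := by
  have hcomm : Commute (LinearMap.mulLeft ℂ (-x)) (LinearMap.mulRight ℂ x) := by
    ext z
    simp [mul_assoc]
  have h1 : LinearMap.mulRight ℂ x - LinearMap.mulLeft ℂ x =
      LinearMap.mulLeft ℂ (-x) + LinearMap.mulRight ℂ x := by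
    ext z
    simp
    abel
  rw [h1, hcomm.add_pow', Finset.sum_antidiagonal_choose_succ_nsmul
    (fun a i => (-x) ^ a * powDeriv x y i) m, ← Finset.sum_add_distrib, LinearMap.sum_apply]
  refine Finset.sum_congr rfl fun p hp => ?_
  have hsymm : m.choose p.2 = m.choose p.1 := by
    rw [← Finset.HasAntidiagonal.mem_antidiagonal.1 hp, Nat.choose_symm_add]
  rw [hsymm, ← smul_add, LinearMap.smul_apply]
  congr 1
  rw [Module.End.mul_apply, LinearMap.pow_mulLeft, LinearMap.pow_mulRight,
    LinearMap.mulLeft_apply, LinearMap.mulRight_apply, powDeriv, pow_succ]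
  noncomm_ring

lemma powDeriv_eq_zero {x y : A} {N : ℕ} (hx : x ^ N = 0) (h : powDeriv x y N = 0) {i : ℕ}
    (hi : N ≤ i) : powDeriv x y i = 0 := by
  induction i, hi using Nat.le_induction with
  | base => exact h
  | succ i hi ih => rw [powDeriv, ih, pow_eq_zero_of_le hi hx, mul_zero, mul_zero, add_zero]

/-- This is e^{-x} d(e^x) = ((1 - e^{-ad x})/ad x) y, grouped by total degree. The vanishing of
`powDeriv x y N` is a separate condition on y: it says that y is tangent to x ^ N = 0. The term of
total degree 0 vanishes, which explains the shift to m + 1. -/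
lemma sum_mul_sum_powDeriv [Algebra ℂ A] {x y : A} {N : ℕ} (hx : x ^ N = 0) (h : powDeriv x y N = 0) :
    (∑ a ∈ Finset.range N, (a.factorial : ℂ)⁻¹ • (-x) ^ a) *
      (∑ i ∈ Finset.range N, (i.factorial : ℂ)⁻¹ • powDeriv x y i) =
    ∑ m ∈ Finset.range (2 * N), ((m + 1).factorial : ℂ)⁻¹ •
      ((LinearMap.mulRight ℂ x - LinearMap.mulLeft ℂ x) ^ m) y := by
  set F : ℕ × ℕ → A := fun p =>
    ((p.1.factorial : ℂ)⁻¹ • (-x) ^ p.1) * ((p.2.factorial : ℂ)⁻¹ • powDeriv x y p.2) with hF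
  have hF0 : ∀ p, F p ≠ 0 → p.1 < N ∧ p.2 < N := by
    intro p hp
    constructor
    · by_contra hlt
      refine hp ?_
      simp only [hF]
      rw [neg_pow, pow_eq_zero_of_le (not_lt.1 hlt) hx, mul_zero, smul_zero, zero_mul]
    · by_contra hlt
      refine hp ?_
      simp only [hF]
      rw [powDeriv_eq_zero hx h (not_lt.1 hlt), smul_zero, mul_zero]
  have hq : ∀ m, ∑ p ∈ Finset.HasAntidiagonal.antidiagonal m, F p = (m.factorial : ℂ)⁻¹ •
      ∑ p ∈ Finset.HasAntidiagonal.antidiagonal m, m.choose p.1 • ((-x) ^ p.1 * powDeriv x y p.2) := by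
    intro m
    rw [Finset.smul_sum]
    refine Finset.sum_congr rfl fun p hp => ?_
    rw [← Finset.HasAntidiagonal.mem_antidiagonal.1 hp]
    simp only [hF]
    rw [smul_mul_smul_comm, ← Nat.cast_smul_eq_nsmul ℂ, smul_smul]
    congr 1
    have h1 : ((p.1 + p.2).factorial : ℂ) ≠ 0 := by exact_mod_cast Nat.factorial_ne_zero _
    have h2 : (p.1.factorial : ℂ) ≠ 0 := by exact_mod_cast Nat.factorial_ne_zero _
    have h3 : (p.2.factorial : ℂ) ≠ 0 := by exact_mod_cast Nat.factorial_ne_zero _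
    have h4 : ((p.1 + p.2).choose p.1 : ℂ) * p.1.factorial * p.2.factorial =
        (p.1 + p.2).factorial := by
      rw [Nat.choose_symm_add]
      exact_mod_cast Nat.add_choose_mul_factorial_mul_factorial p.1 p.2
    field_simp
    rw [← h4]
    ring
  rw [Finset.sum_mul_sum, ← Finset.sum_product',
    ← Finset.sum_fiberwise_of_maps_to (s := Finset.range N ×ˢ Finset.range N)
      (t := Finset.range (2 * N + 1)) (g := fun p => p.1 + p.2) (by
        intro p hp
        simp only [Finset.mem_product, Finset.mem_range] at hp ⊢
        omega),
    Finset.sum_range_succ']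
  have hz : ∀ m, ∑ p ∈ Finset.range N ×ˢ Finset.range N with p.1 + p.2 = m,
      ((p.1.factorial : ℂ)⁻¹ • (-x) ^ p.1) * ((p.2.factorial : ℂ)⁻¹ • powDeriv x y p.2) =
      ∑ p ∈ Finset.HasAntidiagonal.antidiagonal m, F p := by
    intro m
    refine Finset.sum_subset (fun p hp => ?_) fun p hp hp' => ?_
    · rw [Finset.HasAntidiagonal.mem_antidiagonal]
      exact (Finset.mem_filter.1 hp).2
    · by_contra hne
      refine hp' (Finset.mem_filter.2 ⟨?_, Finset.HasAntidiagonal.mem_antidiagonal.1 hp⟩)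
      simpa using hF0 p hne
  simp only [hz]
  rw [Finset.Nat.antidiagonal_zero, Finset.sum_singleton]
  have : F (0, 0) = 0 := by simp [hF, powDeriv]
  rw [this, add_zero]
  exact Finset.sum_congr rfl fun m _ => by rw [hq, sum_choose_powDeriv]

end ExpDerivative

/-! ### Exponentials of families of nilpotent endomorphisms. -/

section LogDerivative

variable {n : ℕ} {V : Type u} [AddCommGroup V] [Module ℂ V]
  {O : Set (Fin n → ℂ)} {j : Fin n} {s : Fin n → ℂ}

/-- By Cayley-Hamilton one exponent serves all nilpotents, so along a family the exponential is a
single fixed polynomial and can be differentiated term by term. -/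
lemma pow_finrank_eq_zero [Module.Finite ℂ V] {x : Module.End ℂ V} (hx : IsNilpotent x) :
    x ^ Module.finrank ℂ V = 0 := by
  have := LinearMap.aeval_self_charpoly x
  rwa [hx.charpoly_eq_X_pow_finrank, map_pow, Polynomial.aeval_X] at this

/-- `((1 - e^{-ad x}) / ad x) y`. -/
noncomputable def leftLogDeriv (x y : Module.End ℂ V) : Module.End ℂ V :=
  ∑ m ∈ Finset.range (2 * Module.finrank ℂ V), ((m + 1).factorial : ℂ)⁻¹ • ((-adEnd x) ^ m) y

lemma leftLogDeriv_mem {M : Submodule ℂ (Module.End ℂ V)} {x y : Module.End ℂ V}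
    (hM : ∀ z ∈ M, x * z - z * x ∈ M) (hy : y ∈ M) : leftLogDeriv x y ∈ M := by
  refine Submodule.sum_mem _ fun m hm => Submodule.smul_mem _ _ ?_
  clear hm
  induction m with
  | zero => simpa using hy
  | succ m ih =>
    rw [pow_succ', Module.End.mul_apply, LinearMap.neg_apply]
    exact Submodule.neg_mem _ (hM _ ih)

variable [Module.Finite ℂ V]

lemma hasPartial_pow {f : (Fin n → ℂ) → Module.End ℂ V} {y : Module.End ℂ V}
    (h : HasPartial j f s y) (i : ℕ) : HasPartial j (fun z => f z ^ i) s (powDeriv (f s) y i) := by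
  induction i with
  | zero => simpa [powDeriv] using HasPartial.const (1 : Module.End ℂ V)
  | succ i ih =>
    simp only [pow_succ']
    exact h.mul ih

variable [Module ℚ (Module.End ℂ V)]

/-- The derivative of the exponential. -/
lemma HasPartial.exp {f : (Fin n → ℂ) → Module.End ℂ V} {y : Module.End ℂ V}
    (h : HasPartial j f s y) (hO : IsOpen O) (hs : s ∈ O) (hf : ∀ z ∈ O, IsNilpotent (f z)) :
    HasPartial j (fun z => IsNilpotent.exp (f z)) s
      (IsNilpotent.exp (f s) * leftLogDeriv (f s) y) := by
  set N := Module.finrank ℂ V with hN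
  have hpow : ∀ z ∈ O, f z ^ N = 0 := fun z hz => pow_finrank_eq_zero (hf z hz)
  -- Tangency: differentiate the identity f ^ N = 0, valid on all of `O`.
  have h0 : powDeriv (f s) y N = 0 := by
    refine (hasPartial_pow h N).unique ?_
    exact (HasPartial.const (0 : Module.End ℂ V)).congr_of_eqOn hO hs fun z hz => hpow z hz
  have h1 : HasPartial j (fun z => IsNilpotent.exp (f z)) s
      (∑ i ∈ Finset.range N, (i.factorial : ℂ)⁻¹ • powDeriv (f s) y i) := by
    refine HasPartial.congr_of_eqOn (HasPartial.sum fun i _ =>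
      (hasPartial_pow h i).const_smul (i.factorial : ℂ)⁻¹) hO hs fun z hz => ?_
    exact exp_eq_sum_complex (hpow z hz)
  have h2 : leftLogDeriv (f s) y = IsNilpotent.exp (-f s) *
      ∑ i ∈ Finset.range N, (i.factorial : ℂ)⁻¹ • powDeriv (f s) y i := by
    have hneg : (-f s) ^ N = 0 := by rw [neg_pow, hpow s hs, mul_zero]
    rw [exp_eq_sum_complex hneg, sum_mul_sum_powDeriv (hpow s hs) h0, leftLogDeriv, adEnd, neg_sub]
  rw [h2, ← mul_assoc, IsNilpotent.exp_mul_exp_neg_self (hf s hs), one_mul]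
  exact h1

lemma IsHol.exp {f : (Fin n → ℂ) → Module.End ℂ V} (h : IsHol O f)
    (hf : ∀ z ∈ O, IsNilpotent (f z)) : IsHol O (fun z => IsNilpotent.exp (f z)) := by
  refine IsHol.congr (IsHol.sum (S := Finset.range (Module.finrank ℂ V)) fun i _ =>
    (h.pow i).const_smul (i.factorial : ℂ)⁻¹) fun z hz => ?_
  exact exp_eq_sum_complex (pow_finrank_eq_zero (hf z hz))

end LogDerivative

/-! ### Leading terms of the logarithmic derivative and of e^{-ad x}. -/

section Auxiliary

variable {V : Type u} [AddCommGroup V] [Module ℂ V] {U : ℤ → Submodule ℂ V}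

lemma leftLogDeriv_of_commute [Module.Finite ℂ V] {x y : Module.End ℂ V} (h : x * y = y * x) :
    leftLogDeriv x y = y := by
  rcases Nat.eq_zero_or_pos (Module.finrank ℂ V) with h0 | h0
  · have : Subsingleton V := Module.finrank_zero_iff.1 h0
    exact Subsingleton.elim _ _
  · obtain ⟨m, hm⟩ : ∃ m, 2 * Module.finrank ℂ V = m + 1 := ⟨2 * Module.finrank ℂ V - 1, by omega⟩
    rw [leftLogDeriv, hm, Finset.sum_range_succ', Finset.sum_eq_zero fun i _ => ?_]
    · simp
    · rw [pow_succ, Module.End.mul_apply]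
      simp [adEnd, h]

lemma neg_adEnd_mem_glBelow {x y : Module.End ℂ V} {c : ℤ} (hx : x ∈ glBelow U (-1))
    (hy : y ∈ glBelow U c) : (-adEnd x) y ∈ glBelow U (c - 1) := by
  have h1 := mul_mem_glBelow hx hy
  have h2 := mul_mem_glBelow hy hx
  rw [show -1 + c = c - 1 by ring] at h1
  rw [← sub_eq_add_neg] at h2
  simpa [adEnd] using Submodule.sub_mem _ h2 h1

lemma neg_adEnd_pow_mem_glBelow {x y : Module.End ℂ V} (hx : x ∈ glBelow U (-1))
    (hy : y ∈ glBelow U (-1)) (m : ℕ) : ((-adEnd x) ^ (m + 1)) y ∈ glBelow U (-2) := by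
  induction m with
  | zero => simpa using neg_adEnd_mem_glBelow hx hy
  | succ m ih =>
    rw [pow_succ', Module.End.mul_apply]
    exact glBelow_mono (by norm_num) (neg_adEnd_mem_glBelow hx ih)

lemma leftLogDeriv_sub_mem_glBelow [Module.Finite ℂ V] {x y : Module.End ℂ V}
    (hx : x ∈ glBelow U (-1)) (hy : y ∈ glBelow U (-1)) :
    leftLogDeriv x y - y ∈ glBelow U (-2) := by
  rcases Nat.eq_zero_or_pos (Module.finrank ℂ V) with h0 | h0
  · have : Subsingleton V := Module.finrank_zero_iff.1 h0
    rw [Subsingleton.elim (leftLogDeriv x y - y) 0]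
    exact Submodule.zero_mem _
  · obtain ⟨m, hm⟩ : ∃ m, 2 * Module.finrank ℂ V = m + 1 := ⟨2 * Module.finrank ℂ V - 1, by omega⟩
    rw [leftLogDeriv, hm, Finset.sum_range_succ']
    simp only [zero_add, Nat.factorial_one, Nat.cast_one, inv_one, one_smul, pow_zero,
      Module.End.one_apply, add_sub_cancel_right]
    exact Submodule.sum_mem _ fun i _ =>
      Submodule.smul_mem _ _ (neg_adEnd_pow_mem_glBelow hx hy i)

lemma exp_neg_adEnd_sub_mem_glBelow [Module ℚ (Module.End ℂ (Module.End ℂ V))]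
    {x y : Module.End ℂ V} (hn : IsNilpotent x)
    (hx : x ∈ glBelow U (-1)) (hy : y ∈ glBelow U (-1)) :
    IsNilpotent.exp (-adEnd x) y - y ∈ glBelow U (-2) := by
  obtain ⟨k, hk⟩ := isNilpotent_neg_adEnd hn
  rw [exp_eq_sum_complex (pow_eq_zero_of_le (Nat.le_succ k) hk), Finset.sum_range_succ']
  simp only [pow_zero, Nat.factorial_zero, Nat.cast_one, inv_one, one_smul, LinearMap.add_apply,
    Module.End.one_apply, add_sub_cancel_right, LinearMap.sum_apply]
  exact Submodule.sum_mem _ fun i _ =>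
    Submodule.smul_mem _ _ (neg_adEnd_pow_mem_glBelow hx hy i)

/-- Used with a = e^{∑ z_j N_j}, e = e^Γ, e' = e^{-Γ}, ω = Ω_j, ν = N_j and c = 2πi s_j, to
recognise the product rule for the frame. -/
lemma mul_smul_conj_add {A : Type*} [Ring A] [Algebra ℂ A] (a : A) {e e' ω ν : A} {c : ℂ}
    (he : e * e' = 1) (hω : c • ω = ν) (l : A) :
    a * e * (c • (e' * ω * e + l)) = a * ν * e + a * (c • (e * l)) := by
  have h : e * (e' * ω * e + l) = ω * e + e * l := by
    rw [mul_add, ← mul_assoc e, ← mul_assoc e, he, one_mul]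
  rw [mul_assoc, mul_smul_comm, h, smul_add, mul_add, ← hω, mul_assoc, smul_mul_assoc]

end Auxiliary

/-! ### The polydisks and the covering map. -/

section Domains

variable {n : ℕ}

lemma isOpen_polydisk (r : ℝ) : IsOpen (polydisk n r) := by
  have : polydisk n r = ⋂ j, {s | ‖s j‖ < r} := by ext; simp [polydisk]
  rw [this]
  exact isOpen_iInter_of_finite fun j => isOpen_lt (by fun_prop) continuous_const

lemma isOpen_puncturedPolydisk (r : ℝ) : IsOpen (puncturedPolydisk n r) := by
  have : puncturedPolydisk n r = ⋂ j, ({s | s j ≠ 0} ∩ {s | ‖s j‖ < r}) := by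
    ext; simp [puncturedPolydisk]
  rw [this]
  exact isOpen_iInter_of_finite fun j =>
    (isOpen_ne_fun (by fun_prop) continuous_const).inter (isOpen_lt (by fun_prop) continuous_const)

lemma isOpen_expMap_preimage {O : Set (Fin n → ℂ)} (hO : IsOpen O) : IsOpen (expMap ⁻¹' O) := by
  refine hO.preimage ?_
  unfold expMap
  fun_prop

lemma puncturedPolydisk_subset (r : ℝ) : puncturedPolydisk n r ⊆ polydisk n r :=
  fun _ hs j => (hs j).2

lemma polydisk_subset {r : ℝ} (hr : r ≤ 1) : polydisk n r ⊆ polydisk n 1 :=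
  fun _ hs j => (hs j).trans_le hr

lemma mem_upperHalf_of_expMap_mem {r : ℝ} (hr : r ≤ 1) {z : Fin n → ℂ}
    (hz : expMap z ∈ puncturedPolydisk n r) : z ∈ upperHalf n := by
  intro j
  have h := (hz j).2.trans_le hr
  rw [norm_expMap, Real.exp_lt_one_iff] at h
  have := Real.two_pi_pos
  by_contra hneg
  nlinarith

lemma exists_expMap_eq {s : Fin n → ℂ} (hs : ∀ j, s j ≠ 0) : ∃ z, expMap z = s := by
  refine ⟨fun j => Complex.log (s j) / (2 * Real.pi * Complex.I), ?_⟩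
  ext j
  rw [expMap, mul_div_cancel₀ _ Complex.two_pi_I_ne_zero, Complex.exp_log (hs j)]

end Domains

namespace IsDeligneBigrading

variable {H : Type u} [AddCommGroup H] [Module ℚ H] {F : ℤ → Submodule ℂ (ℂ ⊗[ℚ] H)}
  {W : ℤ → Submodule ℚ H}

lemma deligneBigrading_spec (h : ∃ I, IsDeligneBigrading F W I) :
    IsDeligneBigrading F W (deligneBigrading F W) := by
  rw [deligneBigrading, dif_pos h]
  exact h.choose_spec

end IsDeligneBigrading

/-! ### The frame of the period map, its logarithmic derivative and horizontality. -/

namespace VGPMHS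

variable {n : ℕ} {𝒱 : VGPMHS.{u} n} {ψ : ℤ → (Fin n → ℂ) → Submodule ℂ 𝒱.V} {r : ℝ}
  {Γ : (Fin n → ℂ) → Module.End ℂ 𝒱.V}

instance : Module.Finite ℚ 𝒱.VQ := 𝒱.finite _

lemma wp_le_qInf (Finf : ℤ → Submodule ℂ 𝒱.V) : 𝒱.wp Finf (-1) ≤ 𝒱.qInf Finf :=
  le_negPart (by norm_num)

lemma commutator_mem_qInf {Finf : ℤ → Submodule ℂ 𝒱.V} {α β : Module.End ℂ 𝒱.V}
    (hα : α ∈ 𝒱.qInf Finf) (hβ : β ∈ 𝒱.qInf Finf) : α * β - β * α ∈ 𝒱.qInf Finf :=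
  commutator_mem_negPart (fun _ h _ h' => commutator_mem_lieG h h') hα hβ

section Admissible

lemma IsAdmissible.N_commute (hψ : 𝒱.IsAdmissible ψ) (i j : Fin n) : Commute (𝒱.N i) (𝒱.N j) := by
  change (𝒱.NQ i).baseChange ℂ * (𝒱.NQ j).baseChange ℂ =
    (𝒱.NQ j).baseChange ℂ * (𝒱.NQ i).baseChange ℂ
  rw [← LinearMap.baseChange_mul, ← LinearMap.baseChange_mul, (hψ.imhm.commute i j).eq]

lemma IsAdmissible.N_isNilpotent (hψ : 𝒱.IsAdmissible ψ) (j : Fin n) : IsNilpotent (𝒱.N j) := by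
  obtain ⟨k, hk⟩ := hψ.imhm.nilpotent j
  refine ⟨k, ?_⟩
  change (𝒱.NQ j).baseChange ℂ ^ k = 0
  rw [← LinearMap.baseChange_pow, hk, LinearMap.baseChange_zero]

lemma IsAdmissible.sum_isNilpotent (hψ : 𝒱.IsAdmissible ψ) (z : Fin n → ℂ) :
    IsNilpotent (∑ j, z j • 𝒱.N j) :=
  Commute.isNilpotent_sum (fun j _ => (hψ.N_isNilpotent j).smul (z j))
    fun i j _ _ => ((hψ.N_commute i j).smul_left (z i)).smul_right (z j)

lemma IsAdmissible.sum_commute_N (hψ : 𝒱.IsAdmissible ψ) (z : Fin n → ℂ) (j : Fin n) :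
    Commute (∑ i, z i • 𝒱.N i) (𝒱.N j) :=
  Commute.sum_left _ _ _ fun i _ => (hψ.N_commute i j).smul_left (z i)

lemma IsAdmissible.relW_shift (hψ : 𝒱.IsAdmissible ψ) (j : Fin n) (k : ℤ) :
    (𝒱.relW k).map (𝒱.NQ j) ≤ 𝒱.relW (k - 2) :=
  hψ.imhm.relative_shift Finset.univ j (Finset.mem_univ j) k

/-- By the convention in `deligneBigrading`, the `U^p` vanish if there is no Deligne bigrading, and
then every endomorphism is homogeneous of every degree (`glGraded_eq_top`). -/
lemma UInf_eq_bot {Finf : ℤ → Submodule ℂ 𝒱.V} (h : ¬ ∃ I, IsDeligneBigrading Finf 𝒱.relW I) :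
    𝒱.UInf Finf = fun _ => ⊥ := by
  funext p
  simp [UInf, hodgeU, deligneBigrading, dif_neg h]

lemma glGraded_eq_top {Finf : ℤ → Submodule ℂ 𝒱.V}
    (h : ¬ ∃ I, IsDeligneBigrading Finf 𝒱.relW I) (a : ℤ) : glGraded (𝒱.UInf Finf) a = ⊤ := by
  rw [eq_top_iff, UInf_eq_bot h]
  intro α _ p x hx
  simp only [Submodule.mem_bot] at hx ⊢
  rw [hx, map_zero]

/-- N_j shifts F_∞ by -1 and, by admissibility for the full index set, ʳW by -2; so it has type
(-1,-1). -/
lemma IsAdmissible.N_mem_wp (hψ : 𝒱.IsAdmissible ψ) (j : Fin n) :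
    𝒱.N j ∈ 𝒱.wp (fun p => ψ p 0) (-1) := by
  refine ⟨hψ.imhm.isometry j, ?_⟩
  by_cases h : ∃ I, IsDeligneBigrading (fun p => ψ p 0) 𝒱.relW I
  · exact (IsDeligneBigrading.deligneBigrading_spec h).mem_glGraded (hψ.imhm.hodge_shift j)
      (hψ.relW_shift j)
  · rw [glGraded_eq_top h]
    exact Submodule.mem_top

lemma IsAdmissible.sum_mem_wp (hψ : 𝒱.IsAdmissible ψ) (z : Fin n → ℂ) :
    ∑ j, z j • 𝒱.N j ∈ 𝒱.wp (fun p => ψ p 0) (-1) :=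
  Submodule.sum_mem _ fun j _ => Submodule.smul_mem _ _ (hψ.N_mem_wp j)

lemma IsAdmissible.hasPartial_expN (hψ : 𝒱.IsAdmissible ψ) (z : Fin n → ℂ) (j : Fin n) :
    HasPartial j 𝒱.expN z (𝒱.expN z * 𝒱.N j) := by
  have h := HasPartial.exp (hasPartial_coord j z 𝒱.N) isOpen_univ (Set.mem_univ z)
    fun w _ => hψ.sum_isNilpotent w
  rwa [leftLogDeriv_of_commute (hψ.sum_commute_N z j).eq] at h

lemma IsAdmissible.isHol_expN (hψ : 𝒱.IsAdmissible ψ) : IsHol Set.univ 𝒱.expN :=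
  IsHol.exp (IsHol.sum fun i _ => IsHol.smul_const (by fun_prop) (𝒱.N i))
    fun w _ => hψ.sum_isNilpotent w

/-- No grading is needed: `IsNilpotent.exp` is 0 on an element that is not nilpotent, and then ψ(s)
= e^{Γ(s)}.F_∞ would vanish in every degree, against ψ(s) being exhaustive, unless V = 0. -/
lemma IsPeriodLog.isNilpotent (hψ : 𝒱.IsAdmissible ψ) (hr : r ≤ 1) (hΓ : 𝒱.IsPeriodLog ψ r Γ)
    {s : Fin n → ℂ} (hs : s ∈ polydisk n r) : IsNilpotent (Γ s) := by
  by_contra hn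
  have h0 : nilpotencyClass (Γ s) = 0 := by
    by_contra h
    exact hn (isNilpotent_of_pos_nilpotencyClass (Nat.pos_of_ne_zero h))
  have hexp : IsNilpotent.exp (Γ s) = 0 := by rw [IsNilpotent.exp, h0, Finset.sum_range_zero]
  obtain ⟨p, hp⟩ := (hψ.filtration s (polydisk_subset hr hs)).eq_top
  have h1 := hΓ.eq s hs p
  rw [hexp, Submodule.map_zero, hp] at h1
  have : Subsingleton 𝒱.V := (Submodule.subsingleton_iff ℂ).1 (subsingleton_of_bot_eq_top h1.symm)
  exact hn (by rw [Subsingleton.elim (Γ s) 0]; exact IsNilpotent.zero)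

lemma IsPeriodLog.partialDeriv_mem (hΓ : 𝒱.IsPeriodLog ψ r Γ) {s : Fin n → ℂ}
    (hs : s ∈ polydisk n r) (j : Fin n) : partialDeriv j Γ s ∈ 𝒱.qInf (fun p => ψ p 0) :=
  (hΓ.holomorphic.hasPartial (isOpen_polydisk r) hs j).mem_of_forall_mem (isOpen_polydisk r) hs
    hΓ.mem

/-- The coefficients of the 1-form `e^{-ad Γ} Ω + e^{-Γ} ∂e^Γ`. -/
noncomputable def logForm (Γ : (Fin n → ℂ) → Module.End ℂ 𝒱.V) (j : Fin n) (s : Fin n → ℂ) :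
    Module.End ℂ 𝒱.V :=
  IsNilpotent.exp (-adEnd (Γ s)) (𝒱.Omega j s) + leftLogDeriv (Γ s) (partialDeriv j Γ s)

lemma IsAdmissible.Omega_mem_wp (hψ : 𝒱.IsAdmissible ψ) (j : Fin n) (s : Fin n → ℂ) :
    𝒱.Omega j s ∈ 𝒱.wp (fun p => ψ p 0) (-1) := Submodule.smul_mem _ _ (hψ.N_mem_wp j)

lemma two_pi_I_mul_ne_zero {s : Fin n → ℂ} (hs : s ∈ puncturedPolydisk n r) (j : Fin n) :
    2 * Real.pi * Complex.I * s j ≠ 0 := mul_ne_zero Complex.two_pi_I_ne_zero (hs j).1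

lemma smul_Omega {s : Fin n → ℂ} (hs : s ∈ puncturedPolydisk n r) (j : Fin n) :
    (2 * Real.pi * Complex.I * s j) • 𝒱.Omega j s = 𝒱.N j := by
  rw [Omega, smul_inv_smul₀ (two_pi_I_mul_ne_zero hs j)]

/-- Both terms are series in ad Γ applied to elements of q_∞, and q_∞ is closed under brackets. -/
lemma logForm_mem_qInf (hψ : 𝒱.IsAdmissible ψ) (hr : r ≤ 1) (hΓ : 𝒱.IsPeriodLog ψ r Γ)
    {s : Fin n → ℂ} (hs : s ∈ polydisk n r) (j : Fin n) :
    logForm Γ j s ∈ 𝒱.qInf (fun p => ψ p 0) := by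
  have had : ∀ z ∈ 𝒱.qInf (fun p => ψ p 0), Γ s * z - z * Γ s ∈ 𝒱.qInf (fun p => ψ p 0) :=
    fun z hz => commutator_mem_qInf (hΓ.mem s hs) hz
  exact Submodule.add_mem _
    (exp_neg_adEnd_mem (hΓ.isNilpotent hψ hr hs) had (wp_le_qInf _ (hψ.Omega_mem_wp j s)))
    (leftLogDeriv_mem had (hΓ.partialDeriv_mem hs j))

/-- The frame `e^{∑ z_j N_j} e^{Γ(s)}` of the period map. -/
noncomputable def frame (Γ : (Fin n → ℂ) → Module.End ℂ 𝒱.V) (z : Fin n → ℂ) :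
    Module.End ℂ 𝒱.V :=
  𝒱.expN z * IsNilpotent.exp (Γ (expMap z))

lemma isHol_frame (hψ : 𝒱.IsAdmissible ψ) (hr : r ≤ 1) (hΓ : 𝒱.IsPeriodLog ψ r Γ) :
    IsHol (expMap ⁻¹' puncturedPolydisk n r) (frame Γ) :=
  (hψ.isHol_expN.mono (Set.subset_univ _)).mul
    (((hΓ.holomorphic.exp fun _ hs => hΓ.isNilpotent hψ hr hs).mono
      (puncturedPolydisk_subset r)).comp_expMap)

lemma isUnit_frame (hψ : 𝒱.IsAdmissible ψ) (hr : r ≤ 1) (hΓ : 𝒱.IsPeriodLog ψ r Γ)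
    {z : Fin n → ℂ} (hz : expMap z ∈ puncturedPolydisk n r) : IsUnit (frame Γ z) :=
  (IsNilpotent.isUnit_exp (hψ.sum_isNilpotent z)).mul
    (IsNilpotent.isUnit_exp (hΓ.isNilpotent hψ hr (puncturedPolydisk_subset r hz)))

/-- The first factor contributes N_j = 2πi s_j Ω_j, conjugated by e^Γ, and the second the
logarithmic derivative of e^Γ. -/
lemma hasPartial_frame (hψ : 𝒱.IsAdmissible ψ) (hr : r ≤ 1) (hΓ : 𝒱.IsPeriodLog ψ r Γ)
    {z : Fin n → ℂ} (hz : expMap z ∈ puncturedPolydisk n r) (j : Fin n) :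
    HasPartial j (frame Γ) z
      (frame Γ z * ((2 * Real.pi * Complex.I * expMap z j) • logForm Γ j (expMap z))) := by
  have hs := puncturedPolydisk_subset r hz
  have hnil := hΓ.isNilpotent hψ hr hs
  have h1 := ((hΓ.holomorphic.hasPartial (isOpen_polydisk r) hs j).exp (isOpen_polydisk r) hs
    fun w hw => hΓ.isNilpotent hψ hr hw).comp_expMap
  have h2 := (hψ.hasPartial_expN z j).mul h1
  have e : logForm Γ j (expMap z) = IsNilpotent.exp (-Γ (expMap z)) * 𝒱.Omega j (expMap z) *
      IsNilpotent.exp (Γ (expMap z)) +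
        leftLogDeriv (Γ (expMap z)) (partialDeriv j Γ (expMap z)) := by
    rw [← exp_neg_adEnd_apply hnil]; rfl
  have e' : frame Γ z * ((2 * Real.pi * Complex.I * expMap z j) • logForm Γ j (expMap z)) =
      𝒱.expN z * 𝒱.N j * IsNilpotent.exp (Γ (expMap z)) +
        𝒱.expN z * ((2 * Real.pi * Complex.I * expMap z j) •
          (IsNilpotent.exp (Γ (expMap z)) *
            leftLogDeriv (Γ (expMap z)) (partialDeriv j Γ (expMap z)))) := by
    rw [e, frame]
    exact mul_smul_conj_add _ (IsNilpotent.exp_mul_exp_neg_self hnil) (smul_Omega hz j) _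
  rw [e']
  exact h2

lemma map_frame (hψ : 𝒱.IsAdmissible ψ) (hr : r ≤ 1) (hΓ : 𝒱.IsPeriodLog ψ r Γ)
    {z : Fin n → ℂ} (hz : expMap z ∈ puncturedPolydisk n r) (p : ℤ) :
    𝒱.period p ⟨z, mem_upperHalf_of_expMap_mem hr hz⟩ = (ψ p 0).map (frame Γ z) := by
  rw [hψ.untwist, hΓ.eq _ (puncturedPolydisk_subset r hz), ← Submodule.map_comp]
  rfl

/-- Griffiths horizontality, in terms of the logarithmic derivative of the frame. -/
lemma logForm_map_hodge (hψ : 𝒱.IsAdmissible ψ) (hr : r ≤ 1) (hΓ : 𝒱.IsPeriodLog ψ r Γ)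
    {s : Fin n → ℂ} (hs : s ∈ puncturedPolydisk n r) (j : Fin n) (p : ℤ) {x : 𝒱.V}
    (hx : x ∈ ψ p 0) : logForm Γ j s x ∈ ψ (p - 1) 0 := by
  obtain ⟨z, rfl⟩ := exists_expMap_eq fun j => (hs j).1
  have hB : IsOpen (expMap ⁻¹' puncturedPolydisk n r) :=
    isOpen_expMap_preimage (isOpen_puncturedPolydisk r)
  have hmem : ∀ w : ↥(upperHalf n), ↑w ∈ expMap ⁻¹' puncturedPolydisk n r →
      frame Γ w x ∈ 𝒱.period p w := by
    intro w hw
    rw [map_frame hψ hr hΓ hw]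
    exact ⟨x, hx, rfl⟩
  -- The section is the frame applied to the fixed vector x. Its derivative lies in g.F_∞^{p-1}, and
  -- injectivity of g then removes the frame.
  have h := 𝒱.hodge_horizontal p (expMap ⁻¹' puncturedPolydisk n r) hB
    (fun w hw => mem_upperHalf_of_expMap_mem hr hw) (fun w => frame Γ w x)
    ((isHol_frame hψ hr hΓ).linear (LinearMap.applyₗ x)) hmem
    ⟨z, mem_upperHalf_of_expMap_mem hr hs⟩ hs j _
    ((hasPartial_frame hψ hr hΓ hs j).linear (LinearMap.applyₗ x))
  change _ ∈ 𝒱.period (p - 1) ⟨z, mem_upperHalf_of_expMap_mem hr hs⟩ at h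
  rw [map_frame hψ hr hΓ hs (p - 1)] at h
  obtain ⟨y, hy, hyx⟩ := h
  have hinj := ((Module.End.isUnit_iff _).1 (isUnit_frame hψ hr hΓ hs)).injective
  have hyx' := hinj hyx
  rw [LinearMap.smul_apply] at hyx'
  rw [hyx'] at hy
  exact (Submodule.smul_mem_iff _ (two_pi_I_mul_ne_zero hs j)).1 hy

/-- If the coefficients of `e^{-ad Γ} Ω + e^{-Γ} ∂e^Γ` have the form `Ω + ∂Γ₁`, then they
commute. -/
lemma logForm_commute (hψ : 𝒱.IsAdmissible ψ) (hr : r ≤ 1) (hΓ : 𝒱.IsPeriodLog ψ r Γ)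
    {Γ₁ : (Fin n → ℂ) → Module.End ℂ 𝒱.V} (hΓ₁ : IsHol (polydisk n r) Γ₁)
    (h : ∀ s ∈ puncturedPolydisk n r, ∀ j,
      logForm Γ j s = 𝒱.Omega j s + partialDeriv j Γ₁ s)
    {s : Fin n → ℂ} (hs : s ∈ puncturedPolydisk n r) (i j : Fin n) :
    logForm Γ i s * logForm Γ j s = logForm Γ j s * logForm Γ i s := by
  obtain ⟨z, rfl⟩ := exists_expMap_eq fun j => (hs j).1
  set B := expMap ⁻¹' puncturedPolydisk n r
  have hB : IsOpen B := isOpen_expMap_preimage (isOpen_puncturedPolydisk r)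
  set G : (Fin n → ℂ) → Module.End ℂ 𝒱.V := fun w => Γ₁ (expMap w)
  have hG : IsHol B G := (hΓ₁.mono (puncturedPolydisk_subset r)).comp_expMap
  have hg := isHol_frame hψ hr hΓ
  have hθ : ∀ w ∈ B, ∀ k, (2 * Real.pi * Complex.I * expMap w k) • logForm Γ k (expMap w) =
      𝒱.N k + partialDeriv k G w := by
    intro w hw k
    rw [h _ hw, smul_add, smul_Omega hw]
    congr 1
    exact ((hΓ₁.hasPartial (isOpen_polydisk r) (puncturedPolydisk_subset r hw) k).comp_expMap).unique
      (hG.hasPartial hB hw k)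
  have hd : ∀ w ∈ B, ∀ k, partialDeriv k (frame Γ) w =
      frame Γ w * (𝒱.N k + partialDeriv k G w) := by
    intro w hw k
    rw [← hθ w hw k]
    exact (hg.hasPartial hB hw k).unique (hasPartial_frame hψ hr hΓ hw k)
  -- Here G is the pullback of Γ₁. The last term is symmetric in k and l, so equality of the mixed
  -- derivatives leaves the commutator alone.
  have hdd : ∀ k l, partialDeriv k (partialDeriv l (frame Γ)) z =
      frame Γ z * (𝒱.N k + partialDeriv k G z) * (𝒱.N l + partialDeriv l G z) +
        frame Γ z * partialDeriv k (partialDeriv l G) z := by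
    intro k l
    refine ((hg.partialDeriv hB l).hasPartial hB hs k).unique ?_
    have h1 : HasPartial k (fun w => 𝒱.N l + partialDeriv l G w) z
        (0 + partialDeriv k (partialDeriv l G) z) :=
      (HasPartial.const _).add ((hG.partialDeriv hB l).hasPartial hB hs k)
    rw [zero_add] at h1
    have h2 := (hg.hasPartial hB hs k).mul h1
    rw [hd z hs k] at h2
    exact h2.congr_of_eqOn hB hs fun w hw => hd w hw l
  have hcomm := partialDeriv_comm hg hB hs i j
  rw [hdd, hdd, partialDeriv_comm hG hB hs i j, add_left_inj, mul_assoc, mul_assoc] at hcomm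
  have hcomm' := (isUnit_frame hψ hr hΓ hs).mul_left_cancel hcomm
  rw [← hθ z hs, ← hθ z hs, smul_mul_smul_comm, smul_mul_smul_comm,
    mul_comm (2 * Real.pi * Complex.I * expMap z j)] at hcomm'
  exact smul_right_injective _
    (mul_ne_zero (two_pi_I_mul_ne_zero hs i) (two_pi_I_mul_ne_zero hs j)) hcomm'

end Admissible

end VGPMHS

/-! ### The components of degree -1 and the Higgs field. -/

namespace VGPMHS

variable {n : ℕ} {𝒱 : VGPMHS.{u} n} {ψ : ℤ → (Fin n → ℂ) → Submodule ℂ 𝒱.V} {r : ℝ}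
  {Γ : (Fin n → ℂ) → Module.End ℂ 𝒱.V}

lemma isInternal_UInf {Finf : ℤ → Submodule ℂ 𝒱.V}
    (h : ∃ I, IsDeligneBigrading Finf 𝒱.relW I) : DirectSum.IsInternal (𝒱.UInf Finf) :=
  (IsDeligneBigrading.deligneBigrading_spec h).isInternal_iSup

lemma hodge_eq_iSup_UInf {Finf : ℤ → Submodule ℂ 𝒱.V}
    (h : ∃ I, IsDeligneBigrading Finf 𝒱.relW I) (p : ℤ) :
    Finf p = ⨆ (r : ℤ) (_ : p ≤ r), 𝒱.UInf Finf r :=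
  (IsDeligneBigrading.deligneBigrading_spec h).hodge p

/-- The 1-form `e^{-ad Γ} Ω + e^{-Γ} ∂e^Γ` takes its values in `℘_{-1}`. -/
lemma logForm_mem_wp (hψ : 𝒱.IsAdmissible ψ) (hr : r ≤ 1) (hΓ : 𝒱.IsPeriodLog ψ r Γ)
    {s : Fin n → ℂ} (hs : s ∈ puncturedPolydisk n r) (j : Fin n) :
    logForm Γ j s ∈ 𝒱.wp (fun p => ψ p 0) (-1) := by
  have hq := logForm_mem_qInf hψ hr hΓ (puncturedPolydisk_subset r hs) j
  by_cases h : ∃ I, IsDeligneBigrading (fun p => ψ p 0) 𝒱.relW I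
  · refine mem_glGraded_of_mem_negPart (isInternal_UInf h) hq fun p x hx => ?_
    rw [← hodge_eq_iSup_UInf h] at hx ⊢
    exact logForm_map_hodge hψ hr hΓ hs j p hx
  -- Without a bigrading the degree condition is empty and only membership in Lie(G_ℂ) remains.
  · refine ⟨negPart_le_self hq, ?_⟩
    rw [glGraded_eq_top h]
    exact Submodule.mem_top

/-- The components of degree `-1` of `Γ` and `X`, and the 1-form `Ω + ∂Γ_{-1}`. The first case of
the proof treats the grading defined by the Deligne bigrading of `(F_∞, ʳW)`, the second one the
convention for filtrations without such a bigrading. -/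
lemma exists_components (hψ : 𝒱.IsAdmissible ψ) (hr : r ≤ 1) (hΓ : 𝒱.IsPeriodLog ψ r Γ) :
    ∃ Γ₁ : (Fin n → ℂ) → Module.End ℂ 𝒱.V, IsHol (polydisk n r) Γ₁ ∧
      (∀ s ∈ polydisk n r, Γ₁ s ∈ 𝒱.wp (fun p => ψ p 0) (-1) ∧
        IsComponent (𝒱.UInf fun p => ψ p 0) (-1) (Γ s) (Γ₁ s)) ∧
      (∀ z, expMap z ∈ puncturedPolydisk n r → IsComponent (𝒱.UInf fun p => ψ p 0) (-1)
        (𝒱.X Γ z) ((∑ j, z j • 𝒱.N j) + Γ₁ (expMap z))) ∧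
      ∀ s ∈ puncturedPolydisk n r, ∀ i j,
        Commute (𝒱.Omega i s + partialDeriv i Γ₁ s) (𝒱.Omega j s + partialDeriv j Γ₁ s) := by
  by_cases h : ∃ I, IsDeligneBigrading (fun p => ψ p 0) 𝒱.relW I
  · obtain ⟨π, hπ, hπ'⟩ := exists_component_map (isInternal_UInf h) (-1)
    have hπlow : ∀ α ∈ glBelow (𝒱.UInf fun p => ψ p 0) (-2), π α = 0 := fun α hα =>
      (glBelow_le (E := LinearMap.ker π) fun a ha β hβ => hπ' a (by omega) β hβ) hα
    have hcomp := fun s hs => component_negPart hπ hπ' (hΓ.mem s hs)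
    have hhol : IsHol (polydisk n r) fun s => π (Γ s) := hΓ.holomorphic.linear π
    refine ⟨fun s => π (Γ s), hhol, fun s hs => ⟨(hcomp s hs).1,
      isComponent_of_sub_mem_glBelow (hcomp s hs).1.2 (hcomp s hs).2⟩, fun z hz => ?_, ?_⟩
    · have hs := puncturedPolydisk_subset r hz
      have h1 := unipotentLog_exp_mul_exp
        (negPart_le_glBelow (wp_le_qInf _ (hψ.sum_mem_wp z))) (negPart_le_glBelow (hΓ.mem _ hs))
        (hψ.sum_isNilpotent z) (hΓ.isNilpotent hψ hr hs)
      refine isComponent_of_sub_mem_glBelow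
        (Submodule.add_mem _ (hψ.sum_mem_wp z).2 (hcomp _ hs).1.2) ?_
      have h2 := Submodule.add_mem _ h1 (hcomp _ hs).2
      rw [X, expN]
      generalize unipotentLog (IsNilpotent.exp (∑ j, z j • 𝒱.N j) *
        IsNilpotent.exp (Γ (expMap z))) = y at h2 ⊢
      rwa [show ∀ x y z w : Module.End ℂ 𝒱.V, x - (y + z) + (z - w) = x - (y + w) by
        intros; abel] at h2
    -- The form equals its own component of degree -1. Modulo degree ≤ -2 it is Ω + ∂Γ, and π
    -- commutes with differentiation.
    · have hform : ∀ s ∈ puncturedPolydisk n r, ∀ j,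
          logForm Γ j s = 𝒱.Omega j s + partialDeriv j (fun s => π (Γ s)) s := by
        intro s hs' j
        have hs := puncturedPolydisk_subset r hs'
        have hΓq := negPart_le_glBelow (hΓ.mem s hs)
        have hd : partialDeriv j (fun s => π (Γ s)) s = π (partialDeriv j Γ s) :=
          (hhol.hasPartial (isOpen_polydisk r) hs j).unique
            ((hΓ.holomorphic.hasPartial (isOpen_polydisk r) hs j).linear π)
        have h1 := hπlow _ (exp_neg_adEnd_sub_mem_glBelow (hΓ.isNilpotent hψ hr hs) hΓq
          (negPart_le_glBelow (wp_le_qInf _ (hψ.Omega_mem_wp j s))))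
        have h2 := hπlow _ (leftLogDeriv_sub_mem_glBelow hΓq
          (negPart_le_glBelow (hΓ.partialDeriv_mem hs j)))
        rw [map_sub, sub_eq_zero] at h1 h2
        rw [← hπ _ (logForm_mem_wp hψ hr hΓ hs' j).2, hd, logForm, map_add, h1, h2,
          hπ _ (hψ.Omega_mem_wp j s).2]
      intro s hs i j
      rw [← hform s hs, ← hform s hs]
      exact logForm_commute hψ hr hΓ hhol hform hs i j
  · have hany : ∀ α β : Module.End ℂ 𝒱.V,
        IsComponent (𝒱.UInf fun p => ψ p 0) (-1) α β := fun α β => by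
      refine isComponent_of_sub_mem (by rw [glGraded_eq_top h]; exact Submodule.mem_top) ?_
      -- Every graded piece is all of gl(V) here; degree 0 is just one choice different from -1.
      refine Submodule.mem_iSup_of_mem 0 (Submodule.mem_iSup_of_mem (by norm_num) ?_)
      rw [glGraded_eq_top h]
      exact Submodule.mem_top
    refine ⟨fun _ => 0, IsHol.const 0, fun s _ => ⟨Submodule.zero_mem _, hany _ _⟩,
      fun z _ => hany _ _, fun s hs i j => ?_⟩
    have h0 : ∀ k : Fin n, partialDeriv k (fun _ => (0 : Module.End ℂ 𝒱.V)) s = 0 := fun k =>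
      ((IsHol.const (O := Set.univ) _).hasPartial isOpen_univ (Set.mem_univ s) k).unique
        (HasPartial.const 0)
    rw [h0, h0, add_zero, add_zero]
    exact ((hψ.N_commute i j).smul_left _).smul_right _

end VGPMHS

open VGPMHS in
theorem theorem6p13 {n : ℕ} (𝒱 : VGPMHS.{u} n)
    (ψ : ℤ → (Fin n → ℂ) → Submodule ℂ 𝒱.V) (hψ : 𝒱.IsAdmissible ψ)
    (r : ℝ) (hr0 : 0 < r) (hr1 : r ≤ 1)
    (Γ : (Fin n → ℂ) → Module.End ℂ 𝒱.V) (hΓ : 𝒱.IsPeriodLog ψ r Γ) :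
    -- e^{-ad Γ} Ω + e^{-Γ} ∂e^Γ takes its values in ℘_{-1}
    (∀ s ∈ puncturedPolydisk n r, ∀ j, ∃ D : Module.End ℂ 𝒱.V,
      HasPartial j (fun s => IsNilpotent.exp (Γ s)) s D ∧
      (IsNilpotent.exp (-adEnd (Γ s))) (𝒱.Omega j s) +
        IsNilpotent.exp (-Γ s) * D ∈ 𝒱.wp (fun p => ψ p 0) (-1)) ∧
    -- the ℘_{-1}-components of Γ and X
    ∃ Γ₁ X₁ : (Fin n → ℂ) → Module.End ℂ 𝒱.V,
      IsHol (polydisk n r) Γ₁ ∧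
      (∀ s ∈ polydisk n r, Γ₁ s ∈ 𝒱.wp (fun p => ψ p 0) (-1) ∧
        IsComponent (𝒱.UInf fun p => ψ p 0) (-1) (Γ s) (Γ₁ s)) ∧
      (∀ z, expMap z ∈ puncturedPolydisk n r → X₁ z ∈ 𝒱.wp (fun p => ψ p 0) (-1) ∧
        IsComponent (𝒱.UInf fun p => ψ p 0) (-1) (𝒱.X Γ z) (X₁ z)) ∧
      -- the 1-form Ω + ∂Γ_{-1} pulls back to ∂X_{-1} and is a Higgs field
      ∃ θ : Fin n → (Fin n → ℂ) → Module.End ℂ 𝒱.V,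
        (∀ s ∈ puncturedPolydisk n r, ∀ j, ∃ D : Module.End ℂ 𝒱.V,
          HasPartial j Γ₁ s D ∧ θ j s = 𝒱.Omega j s + D) ∧
        (∀ z, expMap z ∈ puncturedPolydisk n r → ∀ j,
          HasPartial j X₁ z ((2 * Real.pi * Complex.I * expMap z j) • θ j (expMap z))) ∧
        IsHiggsField (puncturedPolydisk n r) θ := by
  refine ⟨fun s hs j => ?_, ?_⟩
  · have hs' := puncturedPolydisk_subset r hs
    have hnil := hΓ.isNilpotent hψ hr1 hs'
    refine ⟨_, (hΓ.holomorphic.hasPartial (isOpen_polydisk r) hs' j).exp (isOpen_polydisk r) hs'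
      fun z hz => hΓ.isNilpotent hψ hr1 hz, ?_⟩
    rw [← mul_assoc, IsNilpotent.exp_neg_mul_exp_self hnil, one_mul]
    exact logForm_mem_wp hψ hr1 hΓ hs j
  obtain ⟨Γ₁, hhol, hΓ₁, hX, hcomm⟩ := exists_components hψ hr1 hΓ
  -- X_{-1} is the sum of the two logarithms in degree -1, since the commutators in log(e^a e^b)
  -- have degree ≤ -2.
  refine ⟨Γ₁, fun z => (∑ j, z j • 𝒱.N j) + Γ₁ (expMap z), hhol, hΓ₁, fun z hz =>
    ⟨Submodule.add_mem _ (hψ.sum_mem_wp z) (hΓ₁ _ (puncturedPolydisk_subset r hz)).1, hX z hz⟩,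
    fun j s => 𝒱.Omega j s + partialDeriv j Γ₁ s, fun s hs j =>
      ⟨_, hhol.hasPartial (isOpen_polydisk r) (puncturedPolydisk_subset r hs) j, rfl⟩,
    fun z hz j => ?_, fun j => ?_, fun s hs i j => ?_⟩
  · rw [smul_add, smul_Omega hz]
    exact (hasPartial_coord j z 𝒱.N).add
      (hhol.hasPartial (isOpen_polydisk r) (puncturedPolydisk_subset r hz) j).comp_expMap
  · refine IsHol.add (IsHol.smul_const ?_ (𝒱.N j))
      ((hhol.partialDeriv (isOpen_polydisk r) j).mono (puncturedPolydisk_subset r))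
    refine DifferentiableOn.inv (by fun_prop) fun s hs => two_pi_I_mul_ne_zero hs j
  · exact sub_eq_zero.2 (hcomm s hs i j).eq
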